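/- Let $K\ge 1$ users and $L$ transmit antennas be given, with channels $\mathbf h_k\in\mathbb C^L$, noise powers $\sigma_k^2>0$, weights $\delta_k\ge 0$, power budget $P_t>0$ and fixed auxiliary variables $\alpha_{0,k},\alpha_{k,k}\ge 0$, $\beta_{0,k},\beta_{k,k}\in\mathbb C$ ($k\in\mathcal K=\{1,\dots,K\}$). For $\mathbf W=[\mathbf w_0,\dots,\mathbf w_K]\in\mathbb C^{L\times(K+1)}$ and $i\in\{0,k\}$ put $$g_{i,k}(\mathbf W)=2\sqrt{1+\alpha_{i,k}}\,\Re\{\overline{\beta_{i,k}}\,\mathbf h_k^H\mathbf w_i\}-\alpha_{i,k}-|\beta_{i,k}|^2\Big(\sum_{j\in\mathcal K\cup\{i\}}|\mathbf h_k^H\mathbf w_j|^2+\sigma_k^2\Big)+\log(1+\alpha_{i,k}).$$ Consider the convex problem $$\max_{\mathbf W,\,y}\ \max_k\{\delta_k\}\,y+\sum_{k}\delta_k g_{k,k}(\mathbf W)\quad\text{s.t. } y\le g_{0,k}(\mathbf W)\ \ \forall k\in\mathcal K,\qquad \mathrm{tr}(\mathbf W\mathbf W^H)\le P_t, \tag{P5}$$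 with multipliers $\lambda_k\ge0$ for the rate constraints and $\mu\ge0$ for the power constraint. "Optimal dual variables" are the minimizers over $\bm\lambda\ge0,\mu\ge0$ of the Lagrange dual function, i.e. of the supremum over $(\mathbf W,y)$ of the Lagrangian $\max_k\{\delta_k\}y+\sum_k\delta_kg_{k,k}(\mathbf W)-\sum_k\lambda_k(y-g_{0,k}(\mathbf W))-\mu(\mathrm{tr}(\mathbf W\mathbf W^H)-P_t)$. Assume that the power constraint is active in the sense that $\mu^\star>0$ for all optimal dual variables $(\bm\lambda^\star,\mu^\star)$. For $\bm\lambda\ge0$, $\mu>0$ let $\mathbf W(\bm\lambda,\mu)$ have the columns $$\mathbf w_0=\Big(\sum_j\lambda_j|\beta_{0,j}|^2\mathbf h_j\mathbf h_j^H+\mu\mathbf I\Big)^{-1}\sum_j\sqrt{1+\alpha_{0,j}}\,\beta_{0,j}\lambda_j\mathbf h_j,$$ $$\mathbf w_k=\sqrt{1+\alpha_{k,k}}\,\beta_{k,k}\delta_k\Big(\sum_j(\delta_j|\beta_{j,j}|^2+\lambda_j|\beta_{0,j}|^2)\mathbf h_j\mathbf h_j^H+\mu\mathbf I\Big)^{-1}\mathbf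 h_k ,$$ and put $h_{0,k}=g_{0,k}(\mathbf W(\bm\lambda,\mu))$, $q=\mathrm{tr}(\mathbf W(\bm\lambda,\mu)\mathbf W(\bm\lambda,\mu)^H)$. For a constant $\rho\ge0$ the hyperplane fixed point iteration (HFPI) is $$\lambda_k^{[t+1]}=\frac{h_{0,m}^{[t]}+\rho}{h_{0,k}^{[t]}+\rho}\lambda_k^{[t]}\ (k\ne m),\qquad \lambda_m^{[t+1]}=\lambda_m^{[t]}+\sum_{k=1}^K\Big(1-\frac{h_{0,m}^{[t]}+\rho}{h_{0,k}^{[t]}+\rho}\Big)\lambda_k^{[t]},\qquad \mu^{[t+1]}=\frac{q^{[t]}+\rho}{P_t+\rho}\mu^{[t]},$$ where $m=m(t)$ is any user with $h_{0,m}^{[t]}=\min_kh_{0,k}^{[t]}$. Let initial values $\bm\lambda^{[0]}\ge0$ with $\sum_k\lambda_k^{[0]}=\max_k\{\delta_k\}$ and $\mu^{[0]}>0$ be given. Then there is a finite constant $\rho\ge0$ such that for every sequence of HFPI iterates with this $\rho$ started at $(\bm\lambda^{[0]},\mu^{[0]})$, all denominators $h_{0,k}^{[t]}+\rho$ are positive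 and there are optimal dual variables $\bm\lambda^\star,\mu^\star$ of (P5) with $$\lim_{t\to\infty}\|\bm\lambda^{[t]}-\bm\lambda^\star\|_1=0,\qquad \lim_{t\to\infty}|\mu^{[t]}-\mu^\star|=0 .$$ (So the limit is the optimal dual pair whenever that pair is unique.) -/

import Mathlib

open Filter Topology
open scoped Matrix

noncomputable section

/-- Data of the convex beamforming subproblem for `K` users and `L` transmit antennas, with the
auxiliary variables held fixed: maximise `(max_k δ_k) y + ∑_k δ_k g_{k,k}(W)` over `(W, y)` subject
to `y ≤ g_{0,k}(W)` for every user `k` and `tr (W Wᴴ) ≤ P_t`. -/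
structure Subproblem (K L : ℕ) where
  /-- channel vectors `h_k` -/
  h : Fin K → Fin L → ℂ
  /-- noise powers `σ_k²` -/
  noise : Fin K → ℝ
  /-- user weights `δ_k` -/
  δ : Fin K → ℝ
  /-- power budget `P_t` -/
  Pt : ℝ
  /-- auxiliary variables `α_{0,k}` of the common stream -/
  αc : Fin K → ℝ
  /-- auxiliary variables `α_{k,k}` of the private streams -/
  αp : Fin K → ℝ
  /-- auxiliary variables `β_{0,k}` of the common stream -/
  βc : Fin K → ℂ
  /-- auxiliary variables `β_{k,k}` of the private streams -/
  βp : Fin K → ℂ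
  noise_pos : ∀ k, 0 < noise k
  δ_nonneg : ∀ k, 0 ≤ δ k
  Pt_pos : 0 < Pt
  αc_nonneg : ∀ k, 0 ≤ αc k
  αp_nonneg : ∀ k, 0 ≤ αp k

namespace Subproblem

variable {K L : ℕ} (S : Subproblem K L)

/-- `max_k δ_k` (used for `K ≥ 1`). -/
def maxWeight : ℝ := ⨆ k, S.δ k

/-- `h_kᴴ w_i`; column `0` of `W` is the common beamformer, column `k.succ` is the private
beamformer of user `k`. -/
def gain (W : Matrix (Fin L) (Fin (K + 1)) ℂ) (k : Fin K) (i : Fin (K + 1)) : ℂ :=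
  star (S.h k) ⬝ᵥ W.col i

/-- Transmit power `tr (W Wᴴ)`. -/
def power (W : Matrix (Fin L) (Fin (K + 1)) ℂ) : ℝ := (W * Wᴴ).trace.re

/-- Transformed common rate `g_{0,k}(W)`. -/
def gCommon (W : Matrix (Fin L) (Fin (K + 1)) ℂ) (k : Fin K) : ℝ :=
  2 * √(1 + S.αc k) * (star (S.βc k) * S.gain W k 0).re - S.αc k
    - ‖S.βc k‖ ^ 2 * ((∑ j : Fin (K + 1), ‖S.gain W k j‖ ^ 2) + S.noise k)
    + Real.log (1 + S.αc k)

/-- Transformed private rate `g_{k,k}(W)`. -/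
def gPrivate (W : Matrix (Fin L) (Fin (K + 1)) ℂ) (k : Fin K) : ℝ :=
  2 * √(1 + S.αp k) * (star (S.βp k) * S.gain W k k.succ).re - S.αp k
    - ‖S.βp k‖ ^ 2 * ((∑ j : Fin K, ‖S.gain W k j.succ‖ ^ 2) + S.noise k)
    + Real.log (1 + S.αp k)

/-- The Lagrange function of the subproblem. -/
def lagrangian (W : Matrix (Fin L) (Fin (K + 1)) ℂ) (y : ℝ) (lam : Fin K → ℝ) (mu : ℝ) : ℝ :=
  S.maxWeight * y + ∑ k, S.δ k * S.gPrivate W k - ∑ k, lam k * (y - S.gCommon W k)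
    - mu * (power W - S.Pt)

/-- The Lagrange dual function, the supremum of the Lagrange function over `(W, y)`; it may be
`+∞`. -/
def dualFunction (lam : Fin K → ℝ) (mu : ℝ) : EReal :=
  ⨆ (W : Matrix (Fin L) (Fin (K + 1)) ℂ) (y : ℝ), (S.lagrangian W y lam mu : EReal)

/-- `(lam, mu)` is an optimal solution of the Lagrange dual problem: minimise the dual function
over nonnegative multipliers. -/
def IsDualOptimal (lam : Fin K → ℝ) (mu : ℝ) : Prop :=
  (∀ k, 0 ≤ lam k) ∧ 0 ≤ mu ∧
    ∀ (lam' : Fin K → ℝ) (mu' : ℝ), (∀ k, 0 ≤ lam' k) → 0 ≤ mu' →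
      S.dualFunction lam mu ≤ S.dualFunction lam' mu'

/-- The channel matrix `H = [h_1, …, h_K]`. -/
def channel : Matrix (Fin L) (Fin K) ℂ := Matrix.of fun l k => S.h k l

/-- `θ_{0,j} = λ_j |β_{0,j}|²`. -/
def θc (lam : Fin K → ℝ) (j : Fin K) : ℝ := lam j * ‖S.βc j‖ ^ 2

/-- `θ_{j,j} = δ_j |β_{j,j}|² + λ_j |β_{0,j}|²`. -/
def θp (lam : Fin K → ℝ) (j : Fin K) : ℝ := S.δ j * ‖S.βp j‖ ^ 2 + lam j * ‖S.βc j‖ ^ 2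

/-- `d_{0,j} = √(1 + α_{0,j}) β_{0,j} λ_j`. -/
def dc (lam : Fin K → ℝ) (j : Fin K) : ℂ := (√(1 + S.αc j) : ℂ) * S.βc j * (lam j : ℂ)

/-- `d_{k,k} = √(1 + α_{k,k}) β_{k,k} δ_k`. -/
def dp (k : Fin K) : ℂ := (√(1 + S.αp k) : ℂ) * S.βp k * (S.δ k : ℂ)

/-- `H diag(θ) Hᴴ + μ I`; positive definite when `θ ≥ 0` and `μ > 0`. -/
def covMatrix (θ : Fin K → ℝ) (mu : ℝ) : Matrix (Fin L) (Fin L) ℂ :=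
  S.channel * Matrix.diagonal (fun j => (θ j : ℂ)) * S.channelᴴ + (mu : ℂ) • 1

/-- The closed-form beamforming matrix `W(λ, μ)`. -/
def beamformer (lam : Fin K → ℝ) (mu : ℝ) : Matrix (Fin L) (Fin (K + 1)) ℂ :=
  Matrix.of fun l i =>
    Fin.cases (motive := fun _ => ℂ)
      (((S.covMatrix (S.θc lam) mu)⁻¹ *ᵥ (S.channel *ᵥ S.dc lam)) l)
      (fun k => (S.dp k • ((S.covMatrix (S.θp lam) mu)⁻¹ *ᵥ S.h k)) l) i

/-- `h_{0,k}(λ, μ) = g_{0,k}(W(λ, μ))`. -/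
def hCommon (lam : Fin K → ℝ) (mu : ℝ) (k : Fin K) : ℝ := S.gCommon (S.beamformer lam mu) k

/-- `q(λ, μ) = tr (W(λ, μ) W(λ, μ)ᴴ)`. -/
def q (lam : Fin K → ℝ) (mu : ℝ) : ℝ := power (S.beamformer lam mu)

/-- One HFPI update with constant `ρ`, from `(lam, mu)` to `(lam', mu')`, where `m` is a user of
worst common rate at `(lam, mu)` (any such user if there are several). -/
structure HFPIStep (ρ : ℝ) (lam : Fin K → ℝ) (mu : ℝ) (m : Fin K)
    (lam' : Fin K → ℝ) (mu' : ℝ) : Prop where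
  worst : ∀ k, S.hCommon lam mu m ≤ S.hCommon lam mu k
  lam_ne : ∀ k, k ≠ m →
    lam' k = (S.hCommon lam mu m + ρ) / (S.hCommon lam mu k + ρ) * lam k
  lam_worst : lam' m = lam m +
    ∑ k, (1 - (S.hCommon lam mu m + ρ) / (S.hCommon lam mu k + ρ)) * lam k
  mu_eq : mu' = (S.q lam mu + ρ) / (S.Pt + ρ) * mu

/-- `lam`, `mu` is a sequence of HFPI iterates with constant `ρ`. -/
def IsHFPI (ρ : ℝ) (lam : ℕ → Fin K → ℝ) (mu : ℕ → ℝ) : Prop :=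
  ∀ t, ∃ m, S.HFPIStep ρ (lam t) (mu t) m (lam (t + 1)) (mu (t + 1))

end Subproblem

end

/-! Maximising over `y` forces `∑ lam = maxWeight`, so the dual lives on a scaled simplex times `mu
≥ 0`. There, for `mu > 0`, the Lagrangian is a concave quadratic in `W` whose maximiser is the
closed-form beamformer, with quadratic growth of modulus `mu` (`lagrangian_strong_max`). Hence away
from `mu = 0` the dual function has a Lipschitz gradient, with entries `f k` and `P - q` at the
maximiser (`exists_smooth`). HFPI is a scaled descent method for this function: for large `ρ` each
update lowers the dual by a multiple of `residual / ρ`, and its squared length is at most a multiple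
of the residual (`IsStep.basic`, `exists_descent_constant`).

Convergence of the iterates themselves, without uniqueness of the dual solution, comes from finite
length. Relative to one fixed minimiser, a set of dual solutions is described by linear equations
and signs, so Hoffman's bound makes the distance to it at most a multiple of the square root of the
dual gap (`exists_error_bound`). Convexity then bounds the gap to the power `3/4` by the root of the
residual (`exists_lojasiewicz`), and `summable_sqrt_of_descent` makes the step lengths summable.

The delicate point is a circularity: `ρ` depends on a lower bound for `mu`, and that bound must hold
along iterates that depend on `ρ`. It is resolved in `exists_converges`. While the dual gap exceeds
`ε`, a potential combining the dual value with `mu - muS * log mu` drops by at least `ε / 2` per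
update, so this phase has `O(ρ)` updates. Each update multiplies `mu` by at least `exp (-(P / ρ))`,
so the total decay is bounded independently of `ρ`. Once the gap is at most `ε`, positivity of `mu`
at all dual solutions keeps `mu` away from zero by compactness (`exists_sublevel_mu_bound`). -/

noncomputable section

/-! ### Concave quadratic functions. -/

/-- A concave quadratic function, given by its exact second-order expansion. -/
def IsConcaveQuadratic {E : Type*} [NormedAddCommGroup E] [NormedSpace ℝ E] (f : E → ℝ) : Prop :=
  ∃ (c : E →L[ℝ] ℝ) (B : E →L[ℝ] E →L[ℝ] ℝ), (∀ V, 0 ≤ B V V) ∧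
    ∀ W V, f (W + V) = f W + (c V - 2 * B W V) - B V V

namespace IsConcaveQuadratic

variable {E : Type*} [NormedAddCommGroup E] [NormedSpace ℝ E]

theorem const (a : ℝ) : IsConcaveQuadratic fun _ : E => a :=
  ⟨0, 0, by simp, by simp⟩

theorem linear (c : E →L[ℝ] ℝ) : IsConcaveQuadratic fun W => c W :=
  ⟨c, 0, by simp, by simp⟩

theorem add {f g : E → ℝ} (hf : IsConcaveQuadratic f) (hg : IsConcaveQuadratic g) :
    IsConcaveQuadratic fun W => f W + g W := by
  obtain ⟨c, B, hB, h⟩ := hf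
  obtain ⟨c', B', hB', h'⟩ := hg
  refine ⟨c + c', B + B', fun V => ?_, fun W V => ?_⟩
  · simpa using add_nonneg (hB V) (hB' V)
  · simp only [h, h', add_apply]; ring

theorem const_mul {f : E → ℝ} (hf : IsConcaveQuadratic f) {a : ℝ} (ha : 0 ≤ a) :
    IsConcaveQuadratic fun W => a * f W := by
  obtain ⟨c, B, hB, h⟩ := hf
  refine ⟨a • c, a • B, fun V => ?_, fun W V => ?_⟩
  · simpa using mul_nonneg ha (hB V)
  · simp only [h, smul_apply, smul_eq_mul]; ring

theorem sum {ι : Type*} (s : Finset ι) {f : ι → E → ℝ} (hf : ∀ i, IsConcaveQuadratic (f i)) :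
    IsConcaveQuadratic fun W => ∑ i ∈ s, f i W := by
  classical
  induction s using Finset.induction_on with
  | empty => simpa using const (E := E) 0
  | insert i s hi ih => simpa [Finset.sum_insert hi] using (hf i).add ih

theorem neg_norm_sq {F : Type*} [NormedAddCommGroup F] [InnerProductSpace ℝ F] (T : E →L[ℝ] F) :
    IsConcaveQuadratic fun W => -‖T W‖ ^ 2 := by
  refine ⟨0, (innerSL ℝ).bilinearComp T T, fun V => ?_, fun W V => ?_⟩
  · simp
  · simp only [map_add, zero_apply, ContinuousLinearMap.bilinearComp_apply,
      innerSL_apply_apply, real_inner_self_eq_norm_sq]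
    rw [norm_add_sq_real]; ring

theorem lipschitz_on_ball {f : E → ℝ} (hf : IsConcaveQuadratic f) (R : ℝ) :
    ∃ Λ, 0 ≤ Λ ∧ ∀ W W', ‖W‖ ≤ R → ‖W'‖ ≤ R → |f W' - f W| ≤ Λ * ‖W' - W‖ := by
  obtain ⟨c, B, hB, h⟩ := hf
  by_cases hR : 0 ≤ R
  swap
  · exact ⟨0, le_rfl, fun W _ hW => absurd ((norm_nonneg W).trans hW) hR⟩
  refine ⟨‖c‖ + 4 * ‖B‖ * R, by positivity, fun W W' hW hW' => ?_⟩
  have e := h W (W' - W)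
  rw [add_sub_cancel] at e
  have hV : ‖W' - W‖ ≤ 2 * R := (norm_sub_le _ _).trans (by linarith)
  have h1 : |c (W' - W)| ≤ ‖c‖ * ‖W' - W‖ := c.le_opNorm _
  have h2 : |B W (W' - W)| ≤ ‖B‖ * R * ‖W' - W‖ :=
    (B.le_opNorm₂ _ _).trans (by gcongr)
  have h3 : |B (W' - W) (W' - W)| ≤ ‖B‖ * (2 * R) * ‖W' - W‖ :=
    (B.le_opNorm₂ _ _).trans (by gcongr)
  rw [e]
  rw [abs_le] at *
  constructor <;> nlinarith

theorem lipschitz_on_ball_family {ι : Type*} [Fintype ι] {f : ι → E → ℝ}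
    (hf : ∀ i, IsConcaveQuadratic (f i)) (R : ℝ) :
    ∃ Λ, 0 ≤ Λ ∧ ∀ i W W', ‖W‖ ≤ R → ‖W'‖ ≤ R → |f i W' - f i W| ≤ Λ * ‖W' - W‖ := by
  choose Λ hΛ h using fun i => (hf i).lipschitz_on_ball R
  refine ⟨∑ i, Λ i, Finset.sum_nonneg fun i _ => hΛ i, fun i W W' hW hW' => (h i W W' hW hW').trans ?_⟩
  gcongr
  exact Finset.single_le_sum (fun j _ => hΛ j) (Finset.mem_univ i)

end IsConcaveQuadratic

/-! ### The abstract dual problem and the smoothness of its dual function. -/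

/-- Maximisation of `f0` plus a dualised family of concave quadratic constraints, together with
the closed-form maximiser `w lam mu` of the Lagrange function. The multipliers `lam` are
constrained to the simplex `∑ lam = s`. -/
structure DualModel (ι : Type*) [Fintype ι] (E : Type*) [NormedAddCommGroup E]
    [NormedSpace ℝ E] where
  f0 : E → ℝ
  f : ι → E → ℝ
  q : E → ℝ
  w : (ι → ℝ) → ℝ → E
  P : ℝ
  s : ℝ
  C : ℝ
  quad0 : IsConcaveQuadratic f0
  quad : ∀ k, IsConcaveQuadratic (f k)
  quadq : IsConcaveQuadratic fun W => -q W
  sq_norm_le_q : ∀ W, ‖W‖ ^ 2 ≤ q W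
  q_zero : q 0 = 0
  f0_le : ∀ W, f0 W ≤ C
  f_le : ∀ k W, f k W ≤ C
  P_pos : 0 < P
  -- The term `mu * ‖W - w lam mu‖ ^ 2` records strong concavity, inherited from the power penalty
  -- alone; it gives the stability of the maximiser under changes of the multipliers.
  strong_max : ∀ lam mu, (∀ k, 0 ≤ lam k) → 0 < mu → ∀ W,
    (f0 W + ∑ k, lam k * f k W - mu * (q W - P)) + mu * ‖W - w lam mu‖ ^ 2 ≤
      f0 (w lam mu) + ∑ k, lam k * f k (w lam mu) - mu * (q (w lam mu) - P)

namespace DualModel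

variable {ι : Type*} [Fintype ι] {E : Type*} [NormedAddCommGroup E] [NormedSpace ℝ E]
  (M : DualModel ι E)

/-- The Lagrange function. -/
def lag (W : E) (lam : ι → ℝ) (mu : ℝ) : ℝ :=
  M.f0 W + ∑ k, lam k * M.f k W - mu * (M.q W - M.P)

/-- The dual function on `mu > 0`. -/
def dual (lam : ι → ℝ) (mu : ℝ) : ℝ := M.lag (M.w lam mu) lam mu

/-- The multipliers in the scaled simplex. -/
def simplex : Set (ι → ℝ) := {lam | (∀ k, 0 ≤ lam k) ∧ ∑ k, lam k = M.s}

variable {M}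

theorem lag_add_le_dual {lam : ι → ℝ} {mu : ℝ} (hlam : ∀ k, 0 ≤ lam k) (hmu : 0 < mu) (W : E) :
    M.lag W lam mu + mu * ‖W - M.w lam mu‖ ^ 2 ≤ M.dual lam mu :=
  M.strong_max lam mu hlam hmu W

theorem lag_le_dual {lam : ι → ℝ} {mu : ℝ} (hlam : ∀ k, 0 ≤ lam k) (hmu : 0 < mu) (W : E) :
    M.lag W lam mu ≤ M.dual lam mu := by
  have := lag_add_le_dual (M := M) hlam hmu W
  have : 0 ≤ mu * ‖W - M.w lam mu‖ ^ 2 := by positivity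
  linarith

theorem lag_sub_lag (W : E) (lam lam' : ι → ℝ) (mu mu' : ℝ) :
    M.lag W lam' mu' - M.lag W lam mu =
      ∑ k, (lam' k - lam k) * M.f k W + (mu' - mu) * (M.P - M.q W) := by
  simp only [lag, sub_mul, Finset.sum_sub_distrib]; ring

theorem sum_mul_le {lam : ι → ℝ} (hlam : lam ∈ M.simplex) {g : ι → ℝ} {B : ℝ}
    (hg : ∀ k, g k ≤ B) : ∑ k, lam k * g k ≤ M.s * B := by
  rw [← hlam.2, Finset.sum_mul]
  exact Finset.sum_le_sum fun k _ => mul_le_mul_of_nonneg_left (hg k) (hlam.1 k)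

/-- Testing with `W = 0`, where `q` vanishes, shows that the dual grows at least like `mu * P`. This
coercivity bounds the maximisers and the values of `mu` on sublevel sets. -/
theorem exists_lag_zero_ge (M : DualModel ι E) :
    ∃ A, ∀ lam mu, lam ∈ M.simplex → -A + mu * M.P ≤ M.lag 0 lam mu := by
  refine ⟨-(M.f0 0) + M.s * ∑ k, |M.f k 0|, fun lam mu hlam => ?_⟩
  have : ∑ k, lam k * (-M.f k 0) ≤ M.s * ∑ k, |M.f k 0| :=
    sum_mul_le hlam fun k => (neg_le_abs _).trans
      (Finset.single_le_sum (f := fun k => |M.f k 0|) (fun j _ => abs_nonneg _) (Finset.mem_univ k))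
  simp only [mul_neg, Finset.sum_neg_distrib] at this
  simp only [lag, M.q_zero]
  linarith

/-- On multipliers with `mu` bounded below the maximisers and constraint values are bounded. -/
theorem exists_bound (M : DualModel ι E) {mu1 : ℝ} (hmu1 : 0 < mu1) :
    ∃ B, 0 < B ∧ ∀ lam mu, lam ∈ M.simplex → mu1 ≤ mu →
      ‖M.w lam mu‖ ≤ B ∧ (∀ k, |M.f k (M.w lam mu)| ≤ B) ∧ |M.q (M.w lam mu) - M.P| ≤ B := by
  obtain ⟨A, hA⟩ := M.exists_lag_zero_ge
  -- Comparing the Lagrangian at `0` and at the maximiser, the terms `mu * P` cancel and leave `mu *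
  -- q ≤ A + C + s * C`.
  set D := |A + M.C + M.s * M.C| / mu1 with hD
  have hD0 : 0 ≤ D := by positivity
  obtain ⟨Λ, hΛ, hL⟩ := IsConcaveQuadratic.lipschitz_on_ball_family M.quad (1 + D)
  refine ⟨(1 + D) + M.P + Λ * (1 + D) + ∑ k, |M.f k 0|, ?_, fun lam mu hlam hmu => ?_⟩
  · have := M.P_pos
    have : 0 ≤ ∑ k, |M.f k 0| := Finset.sum_nonneg fun _ _ => abs_nonneg _
    positivity
  have hP := M.P_pos
  have hS : 0 ≤ ∑ k, |M.f k 0| := Finset.sum_nonneg fun _ _ => abs_nonneg _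
  have hmu0 : 0 < mu := hmu1.trans_le hmu
  have h1 := lag_le_dual (M := M) hlam.1 hmu0 0
  have h2 := hA lam mu hlam
  have h3 := sum_mul_le hlam (fun k => M.f_le k (M.w lam mu))
  have h4 := M.f0_le (M.w lam mu)
  have hq0 : 0 ≤ M.q (M.w lam mu) := (sq_nonneg _).trans (M.sq_norm_le_q _)
  have hq : M.q (M.w lam mu) ≤ D := by
    rw [hD, le_div_iff₀ hmu1]
    refine le_trans ?_ (le_abs_self _)
    have : M.q (M.w lam mu) * mu1 ≤ M.q (M.w lam mu) * mu := by gcongr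
    simp only [dual, lag] at h1 h2
    linarith
  have hw : ‖M.w lam mu‖ ≤ 1 + D := by
    have := M.sq_norm_le_q (M.w lam mu)
    nlinarith [norm_nonneg (M.w lam mu), sq_nonneg (‖M.w lam mu‖ - 1)]
  have hΛD : 0 ≤ Λ * (1 + D) := by positivity
  refine ⟨by linarith, fun k => ?_, ?_⟩
  · have h5 := hL k 0 (M.w lam mu) (by simp; linarith) hw
    have h6 : |M.f k 0| ≤ ∑ k, |M.f k 0| :=
      Finset.single_le_sum (f := fun k => |M.f k 0|) (fun j _ => abs_nonneg _) (Finset.mem_univ k)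
    have h7 : Λ * ‖M.w lam mu - 0‖ ≤ Λ * (1 + D) := by rw [sub_zero]; gcongr
    have h8 := abs_add_le (M.f k (M.w lam mu) - M.f k 0) (M.f k 0)
    rw [sub_add_cancel] at h8
    linarith
  · rw [abs_le]; constructor <;> linarith

/-- The `ℓ¹` distance between two multiplier pairs. -/
def gapNorm (lam lam' : ι → ℝ) (mu mu' : ℝ) : ℝ := ∑ k, |lam' k - lam k| + |mu' - mu|

theorem gapNorm_nonneg (lam lam' : ι → ℝ) (mu mu' : ℝ) : 0 ≤ gapNorm lam lam' mu mu' :=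
  add_nonneg (Finset.sum_nonneg fun _ _ => abs_nonneg _) (abs_nonneg _)

theorem sum_mul_add_mul_le {lam lam' : ι → ℝ} {mu mu' : ℝ} {g : ι → ℝ} {c B : ℝ}
    (hg : ∀ k, |g k| ≤ B) (hc : |c| ≤ B) :
    ∑ k, (lam' k - lam k) * g k + (mu' - mu) * c ≤ gapNorm lam lam' mu mu' * B := by
  rw [gapNorm, add_mul, Finset.sum_mul]
  refine add_le_add (Finset.sum_le_sum fun k _ => ?_) ?_
  · exact (le_abs_self _).trans (by rw [abs_mul]; gcongr; exact hg k)
  · exact (le_abs_self _).trans (by rw [abs_mul]; gcongr)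

/-- The constraint values are Lipschitz in the multipliers, away from `mu = 0`. -/
theorem exists_lipschitz (M : DualModel ι E) {mu1 : ℝ} (hmu1 : 0 < mu1) :
    ∃ Λ, 0 ≤ Λ ∧ ∀ lam mu lam' mu', lam ∈ M.simplex → mu1 ≤ mu → lam' ∈ M.simplex → mu1 ≤ mu' →
      (∀ k, |M.f k (M.w lam' mu') - M.f k (M.w lam mu)| ≤ Λ * gapNorm lam lam' mu mu') ∧
      |M.q (M.w lam' mu') - M.q (M.w lam mu)| ≤ Λ * gapNorm lam lam' mu mu' := by
  obtain ⟨B, hB, hbd⟩ := M.exists_bound hmu1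
  obtain ⟨Λ₁, hΛ₁, hL₁⟩ := IsConcaveQuadratic.lipschitz_on_ball_family M.quad B
  obtain ⟨Λ₂, hΛ₂, hL₂⟩ := M.quadq.lipschitz_on_ball B
  set Λ := Λ₁ + Λ₂ with hΛdef
  have hΛ : 0 ≤ Λ := by positivity
  refine ⟨Λ * (Λ / mu1), by positivity, fun lam mu lam' mu' hlam hmu hlam' hmu' => ?_⟩
  obtain ⟨hw, -⟩ := hbd lam mu hlam hmu
  obtain ⟨hw', -⟩ := hbd lam' mu' hlam' hmu'
  set W := M.w lam mu
  set W' := M.w lam' mu'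
  have hf : ∀ k, |M.f k W' - M.f k W| ≤ Λ * ‖W' - W‖ := fun k =>
    (hL₁ k W W' hw hw').trans (by gcongr; linarith)
  have hq : |M.q W' - M.q W| ≤ Λ * ‖W' - W‖ := by
    have := (hL₂ W W' hw hw').trans (mul_le_mul_of_nonneg_right
      (show Λ₂ ≤ Λ by linarith) (norm_nonneg _))
    rwa [neg_sub_neg, abs_sub_comm] at this
  have h1 := lag_add_le_dual (M := M) hlam.1 (hmu1.trans_le hmu) W'
  have h2 := lag_add_le_dual (M := M) hlam'.1 (hmu1.trans_le hmu') W
  rw [norm_sub_rev] at h2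
  have h3 := lag_sub_lag (M := M) W lam lam' mu mu'
  have h4 := lag_sub_lag (M := M) W' lam lam' mu mu'
  have h5 := sum_mul_add_mul_le (lam := lam) (lam' := lam') (mu := mu) (mu' := mu')
    (g := fun k => M.f k W' - M.f k W) (c := M.q W - M.q W') hf (by rwa [abs_sub_comm])
  simp only [mul_sub, Finset.sum_sub_distrib] at h5
  have hN := norm_nonneg (W' - W)
  have hG := gapNorm_nonneg lam lam' mu mu'
  -- Adding the two strong-maximum inequalities, each tested at the other maximiser, leaves a
  -- pairing of multiplier differences with constraint differences. The latter are `O(‖W' - W‖)`, so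
  -- one factor of the norm cancels in `h7`.
  have h6 : mu1 * ‖W' - W‖ ^ 2 ≤ gapNorm lam lam' mu mu' * (Λ * ‖W' - W‖) := by
    have e1 : mu1 * ‖W' - W‖ ^ 2 ≤ mu * ‖W' - W‖ ^ 2 := by gcongr
    have e2 : 0 ≤ mu' * ‖W' - W‖ ^ 2 := mul_nonneg (hmu1.le.trans hmu') (sq_nonneg _)
    have e3 : M.dual lam mu = M.lag W lam mu := rfl
    have e4 : M.dual lam' mu' = M.lag W' lam' mu' := rfl
    simp only [mul_sub, sub_mul, Finset.sum_sub_distrib] at h3 h4 h5 ⊢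
    linarith
  have h7 : ‖W' - W‖ ≤ Λ / mu1 * gapNorm lam lam' mu mu' := by
    rcases hN.eq_or_lt with h0 | h0
    · rw [← h0]; positivity
    · rw [div_mul_eq_mul_div, le_div_iff₀ hmu1]
      have : (‖W' - W‖ * mu1) * ‖W' - W‖ ≤ (Λ * gapNorm lam lam' mu mu') * ‖W' - W‖ := by linarith
      exact le_of_mul_le_mul_right this h0
  have h8 : Λ * ‖W' - W‖ ≤ Λ * (Λ / mu1) * gapNorm lam lam' mu mu' := by
    rw [mul_assoc]; gcongr
  exact ⟨fun k => (hf k).trans h8, hq.trans h8⟩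

theorem dual_sub_le {lam lam' : ι → ℝ} {mu mu' : ℝ} (hlam : ∀ k, 0 ≤ lam k) (hmu : 0 < mu) :
    M.dual lam' mu' - M.dual lam mu ≤ ∑ k, (lam' k - lam k) * M.f k (M.w lam' mu') +
      (mu' - mu) * (M.P - M.q (M.w lam' mu')) := by
  have := lag_le_dual (M := M) hlam hmu (M.w lam' mu')
  rw [← lag_sub_lag]
  simp only [dual] at *
  linarith

/-- The descent lemma for the dual function, away from `mu = 0`. -/
theorem exists_smooth (M : DualModel ι E) {mu1 : ℝ} (hmu1 : 0 < mu1) :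
    ∃ Λ, 0 ≤ Λ ∧ ∀ lam mu lam' mu', lam ∈ M.simplex → mu1 ≤ mu → lam' ∈ M.simplex → mu1 ≤ mu' →
      M.dual lam' mu' - M.dual lam mu ≤ ∑ k, (lam' k - lam k) * M.f k (M.w lam mu) +
        (mu' - mu) * (M.P - M.q (M.w lam mu)) + Λ * gapNorm lam lam' mu mu' ^ 2 := by
  obtain ⟨Λ, hΛ, h⟩ := M.exists_lipschitz hmu1
  refine ⟨Λ, hΛ, fun lam mu lam' mu' hlam hmu hlam' hmu' => ?_⟩
  obtain ⟨h1, h2⟩ := h lam mu lam' mu' hlam hmu hlam' hmu'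
  have h3 := dual_sub_le (M := M) (lam' := lam') (mu' := mu') hlam.1 (hmu1.trans_le hmu)
  have h4 := sum_mul_add_mul_le (lam := lam) (lam' := lam') (mu := mu) (mu' := mu')
    (g := fun k => M.f k (M.w lam' mu') - M.f k (M.w lam mu))
    (c := M.q (M.w lam mu) - M.q (M.w lam' mu')) h1 (by rwa [abs_sub_comm])
  simp only [mul_sub, sub_mul, Finset.sum_sub_distrib] at h3 h4 ⊢
  nlinarith

/-- Convexity of the dual function. -/
theorem dual_sub_lag_eq {lam lam' : ι → ℝ} {mu mu' : ℝ} :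
    M.dual lam mu - M.lag (M.w lam mu) lam' mu' =
      ∑ k, (lam k - lam' k) * M.f k (M.w lam mu) + (mu - mu') * (M.P - M.q (M.w lam mu)) :=
  lag_sub_lag _ _ _ _ _

end DualModel

/-! ### Error bounds: Hoffman's inequality and growth of the dual away from its minimisers. -/

/-- Hoffman's error bound for a polyhedron `{x ≥ 0, A x = b}`, on the nonnegative orthant. -/
theorem exists_hoffman_bound {J F : Type*} [Fintype J] [NormedAddCommGroup F] [NormedSpace ℝ F]
    (A : EuclideanSpace ℝ J →L[ℝ] F) (b : F) (x₀ : EuclideanSpace ℝ J) (hx₀ : ∀ j, 0 ≤ x₀ j)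
    (hA : A x₀ = b) :
    ∃ C, 0 ≤ C ∧ ∀ x : EuclideanSpace ℝ J, (∀ j, 0 ≤ x j) →
      ∃ p : EuclideanSpace ℝ J, (∀ j, 0 ≤ p j) ∧ A p = b ∧ ‖x - p‖ ≤ C * ‖A x - b‖ := by
  classical
  set S : Set (EuclideanSpace ℝ J) := {p | (∀ j, 0 ≤ p j) ∧ A p = b} with hS
  have hne : S.Nonempty := ⟨x₀, hx₀, hA⟩
  have hclosed : IsClosed S := by
    have h1 : IsClosed {p : EuclideanSpace ℝ J | ∀ j, 0 ≤ p j} := by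
      rw [Set.ofPred_forall]
      exact isClosed_iInter fun j => isClosed_le continuous_const (by fun_prop)
    exact h1.inter (isClosed_eq A.continuous continuous_const)
  have hconv : Convex ℝ S := by
    rintro p ⟨hp, hp'⟩ r ⟨hr, hr'⟩ a c ha hc hac
    refine ⟨fun j => ?_, ?_⟩
    · have := hp j; have := hr j
      simp only [PiLp.add_apply, PiLp.smul_apply, smul_eq_mul]; positivity
    · rw [map_add, map_smul, map_smul, hp', hr', ← add_smul, hac, one_smul]
  have hproj : ∀ x, ∃ p ∈ S, ∀ r ∈ S, inner ℝ (x - p) (r - p) ≤ 0 := by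
    intro x
    obtain ⟨p, hp, hmin⟩ := exists_norm_eq_iInf_of_complete_convex hne hclosed.isComplete hconv x
    exact ⟨p, hp, (norm_eq_iInf_iff_real_inner_le_zero hconv hp).1 hmin⟩
  -- If no constant works, the unit directions `u n` from projections `p n` to bad points `x n`
  -- accumulate at some `ℓ` in the kernel of `A`. On a common active set `ℓ` is nonnegative, so `ℓ`
  -- is a feasible direction at `p n`; the variational inequality of the projection then forces `⟪ℓ,
  -- ℓ⟫ ≤ 0`, although `‖ℓ‖ = 1`.
  by_contra! hcon
  have hbad : ∀ n : ℕ, ∃ x p : EuclideanSpace ℝ J, (∀ j, 0 ≤ x j) ∧ p ∈ S ∧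
      (∀ r ∈ S, inner ℝ (x - p) (r - p) ≤ 0) ∧ n * ‖A x - b‖ < ‖x - p‖ := by
    intro n
    obtain ⟨x, hx, h⟩ := hcon n n.cast_nonneg
    obtain ⟨p, hp, hp'⟩ := hproj x
    exact ⟨x, p, hx, hp, hp', h p hp.1 hp.2⟩
  choose x p hx hpS hpr hlt using hbad
  have hpos : ∀ n, 0 < ‖x n - p n‖ := fun n => (by positivity : (0:ℝ) ≤ _).trans_lt (hlt n)
  set u : ℕ → EuclideanSpace ℝ J := fun n => ‖x n - p n‖⁻¹ • (x n - p n) with hu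
  have hu1 : ∀ n, ‖u n‖ = 1 := fun n => by
    simp only [hu, norm_smul, norm_inv, norm_norm]
    exact inv_mul_cancel₀ (hpos n).ne'
  -- an infinite set of indices with a common active set
  obtain ⟨I, hI⟩ := Finite.exists_infinite_fiber fun n => Finset.univ.filter fun j => p n j = 0
  set T : Set ℕ := (fun n => Finset.univ.filter fun j => p n j = 0) ⁻¹' {I} with hT
  have hTinf : T.Infinite := Set.infinite_coe_iff.1 hI
  obtain ⟨ℓ, -, φ, hφ, hlim⟩ := (isCompact_sphere (0 : EuclideanSpace ℝ J) 1).tendsto_subseq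
    (x := fun n => u (Nat.nth (· ∈ T) n)) (fun n => by simp [hu1])
  set ψ : ℕ → ℕ := fun n => Nat.nth (· ∈ T) (φ n) with hψ
  have hψmono : StrictMono ψ := (Nat.nth_strictMono hTinf).comp hφ
  have hψT : ∀ n, ψ n ∈ T := fun n => Nat.nth_mem_of_infinite hTinf _
  replace hlim : Tendsto (fun n => u (ψ n)) atTop (𝓝 ℓ) := hlim
  have hact : ∀ n j, p (ψ n) j = 0 ↔ j ∈ I := by
    intro n j
    have : Finset.univ.filter (fun j => p (ψ n) j = 0) = I := hψT n
    rw [← this]; simp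
  have hAℓ : A ℓ = 0 := by
    have h1 : Tendsto (fun n => A (u (ψ n))) atTop (𝓝 (A ℓ)) := (A.continuous.tendsto ℓ).comp hlim
    refine tendsto_nhds_unique h1 (squeeze_zero_norm' (a := fun n => 1 / ((n : ℕ) : ℝ)) ?_
      tendsto_one_div_atTop_nhds_zero_nat)
    filter_upwards [eventually_gt_atTop 0] with n hn
    have hn' : (0:ℝ) < n := by exact_mod_cast hn
    have h2 := hlt (ψ n)
    have h3 : (n : ℝ) ≤ ψ n := by exact_mod_cast hψmono.le_apply
    simp only [hu, map_smul, map_sub, (hpS (ψ n)).2, norm_smul, norm_inv, norm_norm]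
    rw [inv_mul_le_iff₀ (hpos _), mul_one_div, le_div_iff₀ hn']
    nlinarith [norm_nonneg (A (x (ψ n)) - b)]
  have hℓI : ∀ j ∈ I, 0 ≤ ℓ j := by
    intro j hj
    have h1 : Tendsto (fun n => u (ψ n) j) atTop (𝓝 (ℓ j)) :=
      ((by fun_prop : Continuous fun v : EuclideanSpace ℝ J => v j).tendsto ℓ).comp hlim
    refine ge_of_tendsto' h1 fun n => ?_
    have h2 := (hact n j).2 hj
    simp only [hu, PiLp.smul_apply, PiLp.sub_apply, h2, smul_eq_mul, sub_zero]
    exact mul_nonneg (inv_nonneg.2 (hpos _).le) (hx _ j)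
  have hstep : ∀ n, inner ℝ (u (ψ n)) ℓ ≤ 0 := by
    intro n
    have hev : ∀ᶠ t : ℝ in 𝓝[>] 0, ∀ j, 0 ≤ (p (ψ n) + t • ℓ) j := by
      rw [eventually_all]
      intro j
      simp only [PiLp.add_apply, PiLp.smul_apply, smul_eq_mul]
      by_cases hj : j ∈ I
      · filter_upwards [self_mem_nhdsWithin] with t ht
        exact add_nonneg ((hpS _).1 j) (mul_nonneg (le_of_lt ht) (hℓI j hj))
      · have h1 : 0 < p (ψ n) j := lt_of_le_of_ne ((hpS _).1 j) fun h => hj ((hact n j).1 h.symm)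
        have h2 : Tendsto (fun t : ℝ => p (ψ n) j + t * ℓ j) (𝓝 0) (𝓝 (p (ψ n) j + 0 * ℓ j)) := by
          apply Continuous.tendsto (f := fun t : ℝ => p (ψ n) j + t * ℓ j); fun_prop
        rw [zero_mul, add_zero] at h2
        exact nhdsWithin_le_nhds ((h2.eventually (lt_mem_nhds h1)).mono fun t ht => ht.le)
    obtain ⟨t, ht, ht0⟩ := (hev.and self_mem_nhdsWithin).exists
    have ht0 : 0 < t := ht0
    have h1 := hpr (ψ n) (p (ψ n) + t • ℓ) ⟨ht, by rw [map_add, map_smul, hAℓ, smul_zero,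
      add_zero, (hpS _).2]⟩
    rw [add_sub_cancel_left, inner_smul_right] at h1
    have h2 : inner ℝ (x (ψ n) - p (ψ n)) ℓ ≤ 0 := by
      by_contra! h; exact absurd h1 (not_le.2 (mul_pos ht0 h))
    simp only [hu, real_inner_smul_left]
    exact mul_nonpos_of_nonneg_of_nonpos (inv_nonneg.2 (hpos _).le) h2
  have h1 : Tendsto (fun n => inner ℝ (u (ψ n)) ℓ) atTop (𝓝 (inner ℝ ℓ ℓ)) :=
    hlim.inner tendsto_const_nhds
  have h2 : Tendsto (fun n => ‖u (ψ n)‖) atTop (𝓝 ‖ℓ‖) := hlim.norm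
  simp only [hu1] at h2
  have h3 : ‖ℓ‖ = 1 := tendsto_nhds_unique h2 tendsto_const_nhds
  have h4 := le_of_tendsto' h1 hstep
  rw [real_inner_self_eq_norm_sq, h3] at h4
  norm_num at h4

/-- Replacing `V` by `t • V` gives a quadratic in `t` that is never negative, and its discriminant
gives the bound. It turns a small gap in the Lagrangian into a small derivative. -/
theorem norm_le_of_le_add_mul_sq {E : Type*} [NormedAddCommGroup E] [NormedSpace ℝ E]
    {r : E →L[ℝ] ℝ} {g C : ℝ} (h : ∀ V, r V ≤ g + C * ‖V‖ ^ 2) : ‖r‖ ≤ 2 * √(C * g) := by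
  refine r.opNorm_le_bound (by positivity) fun V => ?_
  have h1 : ∀ t : ℝ, 0 ≤ (C * ‖V‖ ^ 2) * (t * t) + (-(r V)) * t + g := by
    intro t
    have := h (t • V)
    rw [map_smul, smul_eq_mul, norm_smul, mul_pow, Real.norm_eq_abs, sq_abs] at this
    linarith
  have h2 := discrim_le_zero h1
  rw [discrim] at h2
  have h3 : r V ^ 2 ≤ 4 * ‖V‖ ^ 2 * (C * g) := by linarith
  rw [Real.norm_eq_abs]
  refine (Real.abs_le_sqrt h3).trans (le_of_eq ?_)
  rw [Real.sqrt_mul (by positivity), show 4 * ‖V‖ ^ 2 = (2 * ‖V‖) ^ 2 by ring,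
    Real.sqrt_sq (by positivity)]
  ring

namespace DualModel

variable {ι : Type*} [Fintype ι] {E : Type*} [NormedAddCommGroup E] [NormedSpace ℝ E]
  {M : DualModel ι E}

/-- A minimiser of the dual function with `mu > 0`. -/
structure IsMinimizer (M : DualModel ι E) (lamS : ι → ℝ) (muS : ℝ) : Prop where
  mem : lamS ∈ M.simplex
  pos : 0 < muS
  le : ∀ lam mu, lam ∈ M.simplex → 0 < mu → M.dual lamS muS ≤ M.dual lam mu

variable {lamS : ι → ℝ} {muS : ℝ}

/-- Move a fraction `t` along the segment towards `(lam, mu)`, apply the descent inequality, divide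
by `t` and let `t → 0`. -/
theorem IsMinimizer.first_order (h : M.IsMinimizer lamS muS) {lam : ι → ℝ} {mu : ℝ}
    (hlam : lam ∈ M.simplex) (hmu : 0 < mu) :
    0 ≤ ∑ k, (lam k - lamS k) * M.f k (M.w lamS muS) +
      (mu - muS) * (M.P - M.q (M.w lamS muS)) := by
  obtain ⟨Λ, hΛ, hs⟩ := M.exists_smooth (lt_min hmu h.pos)
  set X := ∑ k, (lam k - lamS k) * M.f k (M.w lamS muS) +
      (mu - muS) * (M.P - M.q (M.w lamS muS)) with hX
  set G := gapNorm lamS lam muS mu with hG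
  have key : ∀ t : ℝ, 0 < t → t ≤ 1 → 0 ≤ X + Λ * G ^ 2 * t := by
    intro t ht ht1
    have hm1 : min mu muS ≤ muS + t * (mu - muS) := by
      have h1 := min_le_left mu muS
      have h2 := min_le_right mu muS
      nlinarith
    have hmem : (fun k => lamS k + t * (lam k - lamS k)) ∈ M.simplex := by
      refine ⟨fun k => ?_, ?_⟩
      · have h1 := hlam.1 k
        have h2 := h.mem.1 k
        have h3 : 0 ≤ (1 - t) * lamS k + t * lam k :=
          add_nonneg (mul_nonneg (by linarith) h2) (mul_nonneg ht.le h1)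
        linarith
      · rw [Finset.sum_add_distrib, ← Finset.mul_sum, Finset.sum_sub_distrib, hlam.2, h.mem.2]
        ring
    have h1 := hs lamS muS _ _ h.mem (min_le_right _ _) hmem hm1
    have h2 := h.le _ _ hmem ((lt_min hmu h.pos).trans_le hm1)
    have h3 : gapNorm lamS (fun k => lamS k + t * (lam k - lamS k)) muS (muS + t * (mu - muS))
        = t * G := by
      simp only [gapNorm, hG, add_sub_cancel_left, abs_mul, abs_of_pos ht, mul_add, Finset.mul_sum]
    rw [h3] at h1
    simp only [add_sub_cancel_left, mul_assoc, ← Finset.mul_sum] at h1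
    have h4 : 0 ≤ t * (X + Λ * G ^ 2 * t) := by
      simp only [hX]; nlinarith
    exact nonneg_of_mul_nonneg_right h4 ht
  have h1 : Tendsto (fun t : ℝ => X + Λ * G ^ 2 * t) (𝓝[>] 0) (𝓝 X) := by
    have : Tendsto (fun t : ℝ => X + Λ * G ^ 2 * t) (𝓝 0) (𝓝 (X + Λ * G ^ 2 * 0)) :=
      Continuous.tendsto (by fun_prop) _
    rw [mul_zero, add_zero] at this
    exact this.mono_left nhdsWithin_le_nhds
  refine ge_of_tendsto h1 ?_
  filter_upwards [Ioc_mem_nhdsGT (zero_lt_one (α := ℝ))] with t ht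
  exact key t ht.1 ht.2

/-- Since `muS > 0` is interior, both directions of change, to `muS / 2` and to `2 * muS`, are
allowed. -/
theorem IsMinimizer.q_eq (h : M.IsMinimizer lamS muS) : M.q (M.w lamS muS) = M.P := by
  have h1 := h.first_order h.mem (half_pos h.pos)
  have h2 := h.first_order h.mem (mul_pos two_pos h.pos)
  simp only [sub_self, zero_mul, Finset.sum_const_zero, zero_add] at h1 h2
  have := h.pos
  nlinarith

theorem IsMinimizer.sum_le (h : M.IsMinimizer lamS muS) {lam : ι → ℝ} (hlam : lam ∈ M.simplex) :
    ∑ k, lamS k * M.f k (M.w lamS muS) ≤ ∑ k, lam k * M.f k (M.w lamS muS) := by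
  have h1 := h.first_order hlam h.pos
  simp only [sub_self, zero_mul, add_zero, sub_mul, Finset.sum_sub_distrib] at h1
  linarith

theorem IsMinimizer.lag_eq (h : M.IsMinimizer lamS muS) (lam : ι → ℝ) (mu : ℝ) :
    M.lag (M.w lamS muS) lam mu = M.dual lamS muS + (∑ k, lam k * M.f k (M.w lamS muS) -
      ∑ k, lamS k * M.f k (M.w lamS muS)) := by
  simp only [dual, lag, h.q_eq]; ring

/-- The dual function controls the distance to its set of minimisers. -/
theorem IsMinimizer.exists_error_bound (h : M.IsMinimizer lamS muS) (mu2 e : ℝ) :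
    ∃ C, 0 ≤ C ∧ ∀ lam mu, lam ∈ M.simplex → 0 < mu → mu ≤ mu2 →
      M.dual lam mu ≤ M.dual lamS muS + e →
      ∃ lamP muP, lamP ∈ M.simplex ∧ 0 ≤ muP ∧ (∀ W, M.lag W lamP muP ≤ M.dual lamS muS) ∧
        gapNorm lam lamP mu muP ≤ C * √(M.dual lam mu - M.dual lamS muS) := by
  obtain ⟨c0, B0, hB0, h0⟩ := M.quad0
  choose c B hB hf using M.quad
  obtain ⟨cq, Bq, hBq, hq⟩ := M.quadq
  set Wst := M.w lamS muS with hWst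
  set G : ι → E →L[ℝ] ℝ := fun k => c k - (2 : ℝ) • B k Wst with hG
  set G0 : E →L[ℝ] ℝ := c0 - (2 : ℝ) • B0 Wst with hG0
  set Gq : E →L[ℝ] ℝ := cq - (2 : ℝ) • Bq Wst with hGq
  set r : (ι → ℝ) → ℝ → E →L[ℝ] ℝ := fun lam mu => G0 + (∑ k, lam k • G k + mu • Gq) with hr
  have expand : ∀ lam mu V, M.lag (Wst + V) lam mu = M.lag Wst lam mu + r lam mu V -
      (B0 V V + ∑ k, lam k * B k V V + mu * Bq V V) := by
    intro lam mu V
    have e1 : M.q (Wst + V) = M.q Wst - (Gq V - Bq V V) := by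
      have := hq Wst V
      simp only [hGq, sub_apply, smul_apply, smul_eq_mul]
      linarith
    simp only [lag, h0, hf, e1, hr, hG, hG0, add_apply, sub_apply, smul_apply, smul_eq_mul,
      mul_add, mul_sub, Finset.sum_add_distrib, Finset.sum_sub_distrib, sum_apply]
    ring
  have Qnonneg : ∀ (lam : ι → ℝ) (mu : ℝ) (V : E), (∀ k, 0 ≤ lam k) → 0 ≤ mu →
      0 ≤ B0 V V + ∑ k, lam k * B k V V + mu * Bq V V := fun lam mu V hl hm =>
    add_nonneg (add_nonneg (hB0 V) (Finset.sum_nonneg fun k _ => mul_nonneg (hl k) (hB k V)))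
      (mul_nonneg hm (hBq V))
  have Qle : ∀ mu2 : ℝ, ∃ Cq, ∀ lam mu V, lam ∈ M.simplex → 0 ≤ mu → mu ≤ mu2 →
      B0 V V + ∑ k, lam k * B k V V + mu * Bq V V ≤ Cq * ‖V‖ ^ 2 := by
    intro mu2
    have bd : ∀ (T : E →L[ℝ] E →L[ℝ] ℝ) V, T V V ≤ ‖T‖ * ‖V‖ ^ 2 := fun T V =>
      (le_abs_self _).trans ((T.le_opNorm₂ V V).trans_eq (by ring))
    refine ⟨‖B0‖ + M.s * ∑ k, ‖B k‖ + mu2 * ‖Bq‖, fun lam mu V hl hm hm2 => ?_⟩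
    have e1 : ∑ k, lam k * B k V V ≤ M.s * ((∑ k, ‖B k‖) * ‖V‖ ^ 2) :=
      sum_mul_le hl fun k => (bd _ _).trans (mul_le_mul_of_nonneg_right
        (Finset.single_le_sum (f := fun k => ‖B k‖) (fun j _ => norm_nonneg (B j))
          (Finset.mem_univ k)) (sq_nonneg _))
    have e2 : mu * Bq V V ≤ mu2 * (‖Bq‖ * ‖V‖ ^ 2) :=
      mul_le_mul hm2 (bd _ _) (hBq V) (hm.trans hm2)
    have e3 := bd B0 V
    linarith
  have rnorm : ∀ mu2 : ℝ, ∃ Cq, ∀ lam mu, lam ∈ M.simplex → 0 < mu → mu ≤ mu2 →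
      ‖r lam mu‖ ≤ 2 * √(Cq * (M.dual lam mu - M.lag Wst lam mu)) := by
    intro mu2
    obtain ⟨Cq, hCq⟩ := Qle mu2
    refine ⟨Cq, fun lam mu hl hm hm2 => norm_le_of_le_add_mul_sq fun V => ?_⟩
    have e1 := lag_le_dual (M := M) hl.1 hm (Wst + V)
    have e2 := hCq lam mu V hl hm.le hm2
    rw [expand] at e1
    linarith
  have rS : r lamS muS = 0 := by
    obtain ⟨Cq, hCq⟩ := rnorm muS
    have := hCq lamS muS h.mem h.pos le_rfl
    have e : M.dual lamS muS - M.lag Wst lamS muS = 0 := sub_self _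
    rw [e, mul_zero, Real.sqrt_zero, mul_zero] at this
    exact norm_le_zero_iff.1 this
  -- The columns of a linear system in `(lam, mu)`, with `none` indexing `mu`. It encodes three
  -- conditions at the fixed point `Wst`: the sum of `lam` is `s`, complementary slackness holds,
  -- and the derivative `r lam mu` of the Lagrangian vanishes.
  set a : Option ι → ℝ × ℝ × (E →L[ℝ] ℝ) :=
    fun o => o.elim (0, 0, Gq) fun k => (1, M.f k Wst, G k) with ha
  set A : EuclideanSpace ℝ (Option ι) →L[ℝ] ℝ × ℝ × (E →L[ℝ] ℝ) :=
    ∑ o, (EuclideanSpace.proj o : EuclideanSpace ℝ (Option ι) →L[ℝ] ℝ).smulRight (a o) with hA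
  set fS := ∑ k, lamS k * M.f k Wst with hfS
  set z : (ι → ℝ) → ℝ → EuclideanSpace ℝ (Option ι) :=
    fun lam mu => WithLp.toLp 2 fun o => o.elim mu lam with hz
  have hAx : ∀ x, A x = (∑ k, x (some k), ∑ k, x (some k) * M.f k Wst,
      ∑ k, x (some k) • G k + x none • Gq) := by
    intro x
    have e1 : A x = x none • a none + ∑ k, x (some k) • a (some k) := by
      simp only [hA, sum_apply, ContinuousLinearMap.smulRight_apply, add_apply, PiLp.proj_apply,
        Fintype.sum_option]
    rw [e1]
    refine Prod.ext ?_ (Prod.ext ?_ ?_)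
    · simp [ha, Prod.fst_sum]
    · simp [ha, Prod.fst_sum, Prod.snd_sum]
    · simp only [ha, Option.elim, Prod.snd_add, Prod.snd_sum, Prod.smul_snd]
      rw [add_comm]
  have hAz : ∀ lam mu, A (z lam mu) =
      (∑ k, lam k, ∑ k, lam k * M.f k Wst, r lam mu - G0) := by
    intro lam mu
    rw [hAx]
    simp [hz, hr]
  obtain ⟨C, hC, hoff⟩ := exists_hoffman_bound A (M.s, fS, -G0) (z lamS muS)
    (by rintro (_ | k); exacts [h.pos.le, h.mem.1 k])
    (by rw [hAz, rS, h.mem.2, zero_sub])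
  obtain ⟨Cq, hCq⟩ := rnorm mu2
  refine ⟨(Fintype.card ι + 1) * (C * (√e + 2 * √|Cq|)), by positivity,
    fun lam mu hl hm hm2 hD => ?_⟩
  obtain ⟨p, hp, hpA, hpx⟩ := hoff (z lam mu) (by rintro (_ | k); exacts [hm.le, hl.1 k])
  rw [hAx, Prod.mk.injEq, Prod.mk.injEq] at hpA
  obtain ⟨hp1, hp2, hp3⟩ := hpA
  have hrp : r (fun k => p (some k)) (p none) = 0 := by
    simp only [hr, hp3, add_neg_cancel]
  refine ⟨fun k => p (some k), p none, ⟨fun k => hp _, hp1⟩, hp none, fun W => ?_, ?_⟩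
  -- A concave function that is stationary at `Wst` is maximal there, so the Lagrangian at the
  -- projected multipliers is bounded by the optimal value, even if `p none = 0`.
  · have e1 := expand (fun k => p (some k)) (p none) (W - Wst)
    have e2 := Qnonneg (fun k => p (some k)) (p none) (W - Wst) (fun k => hp _) (hp _)
    have e3 := h.lag_eq (fun k => p (some k)) (p none)
    rw [add_sub_cancel, hrp, zero_apply] at e1
    rw [← hWst] at e3
    simp only [hp2, hfS] at e3
    linarith
  · set D := M.dual lam mu - M.dual lamS muS with hDdef
    have hD0 : 0 ≤ D := sub_nonneg.2 (h.le lam mu hl hm)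
    have hgap0 := h.sum_le hl
    have hlag := h.lag_eq lam mu
    rw [← hWst] at hgap0 hlag
    have hgapD : ∑ k, lam k * M.f k Wst - fS ≤ D := by
      have := lag_le_dual (M := M) hl.1 hm Wst
      linarith
    have hrD : ‖r lam mu‖ ≤ 2 * √|Cq| * √D := by
      refine (hCq lam mu hl hm hm2).trans ?_
      rw [mul_assoc, ← Real.sqrt_mul (abs_nonneg _)]
      gcongr
      · have := lag_le_dual (M := M) hl.1 hm Wst
        linarith
      · exact le_abs_self _
      · linarith
    -- The slackness residual is linear in `D`, the derivative residual only `√D`; on the sublevel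
    -- set the former is absorbed in the latter.
    have hDe : D ≤ √e * √D := by
      have he : D ≤ e := by linarith
      calc D = √D * √D := (Real.mul_self_sqrt hD0).symm
        _ ≤ √e * √D := by gcongr
    have hres : ‖A (z lam mu) - (M.s, fS, -G0)‖ ≤ (√e + 2 * √|Cq|) * √D := by
      rw [hAz, Prod.mk_sub_mk, Prod.mk_sub_mk, hl.2, sub_self, sub_neg_eq_add, sub_add_cancel]
      have n1 : 0 ≤ √e * √D := by positivity
      have n2 : 0 ≤ 2 * √|Cq| * √D := by positivity
      rw [add_mul]
      refine norm_prod_le_iff.2 ⟨by simp only [norm_zero]; linarith, norm_prod_le_iff.2 ⟨?_, ?_⟩⟩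
      · simp only [Real.norm_eq_abs]
        rw [abs_of_nonneg (by linarith)]
        linarith
      · simp only; linarith
    have hpx' : ∀ o, |p o - z lam mu o| ≤ C * ((√e + 2 * √|Cq|) * √D) := fun o =>
      calc |p o - z lam mu o| = ‖(z lam mu - p) o‖ := by
            rw [PiLp.sub_apply, Real.norm_eq_abs, abs_sub_comm]
        _ ≤ ‖z lam mu - p‖ := PiLp.norm_apply_le _ _
        _ ≤ _ := hpx.trans (by gcongr)
    calc gapNorm lam (fun k => p (some k)) mu (p none)
        ≤ ∑ _k : ι, C * ((√e + 2 * √|Cq|) * √D) + C * ((√e + 2 * √|Cq|) * √D) :=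
          add_le_add (Finset.sum_le_sum fun k _ => hpx' (some k)) (hpx' none)
      _ = _ := by
          rw [Finset.sum_const, Finset.card_univ, nsmul_eq_mul]; ring

end DualModel

/-! ### Finite length of descent sequences. -/

/-- A descent sequence with Łojasiewicz exponent `3/4` has finite length. -/
theorem summable_sqrt_of_descent {e g : ℕ → ℝ} {κ C : ℝ} (hκ : 0 < κ) (hC : 0 ≤ C)
    (he : ∀ t, 0 ≤ e t) (hg : ∀ t, 0 ≤ g t) (hdesc : ∀ t, e (t + 1) ≤ e t - κ * g t)
    (hloj : ∀ t, e t ≤ C * √√(e t) * √(g t)) :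
    Summable (fun t => √(g t)) ∧ Tendsto e atTop (𝓝 0) := by
  set a : ℕ → ℝ := fun t => √√(e t) with ha
  have ha0 : ∀ t, 0 ≤ a t := fun t => Real.sqrt_nonneg _
  have ha4 : ∀ t, a t ^ 4 = e t := fun t => by
    rw [show a t ^ 4 = (√√(e t) ^ 2) ^ 2 by simp only [ha]; ring,
      Real.sq_sqrt (Real.sqrt_nonneg _), Real.sq_sqrt (he t)]
  have hanti : ∀ t, a (t + 1) ≤ a t := fun t => by
    apply Real.sqrt_le_sqrt
    apply Real.sqrt_le_sqrt
    have := hdesc t; have := mul_nonneg hκ.le (hg t); linarith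
  have hstep : ∀ t, √(g t) ≤ 4 * C / κ * (a t - a (t + 1)) := by
    intro t
    have hx := ha0 t; have hy := ha0 (t + 1); have hxy := hanti t
    -- With `a = e ^ (1/4)`, this is concavity of the fourth root. Combined with `a ^ 3 ≤ C * √g` it
    -- bounds `√g` by a telescoping difference.
    have h1 : κ * g t ≤ 4 * a t ^ 3 * (a t - a (t + 1)) := by
      have e1 := hdesc t
      rw [← ha4 t, ← ha4 (t + 1)] at e1
      have e2 : a t ^ 4 - a (t + 1) ^ 4 =
          (a t - a (t + 1)) * (a t ^ 3 + a t ^ 2 * a (t + 1) + a t * a (t + 1) ^ 2 +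
            a (t + 1) ^ 3) := by ring
      have e3 : a t ^ 3 + a t ^ 2 * a (t + 1) + a t * a (t + 1) ^ 2 + a (t + 1) ^ 3
          ≤ 4 * a t ^ 3 := by
        have f1 : a t ^ 2 * a (t + 1) ≤ a t ^ 2 * a t := by gcongr
        have f2 : a t * a (t + 1) ^ 2 ≤ a t * a t ^ 2 := by gcongr
        have f3 : a (t + 1) ^ 3 ≤ a t ^ 3 := by gcongr
        linarith
      have e4 := mul_le_mul_of_nonneg_left e3 (sub_nonneg.2 hxy)
      linarith
    have h2 : a t ^ 3 ≤ C * √(g t) := by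
      rcases hx.eq_or_lt with h0 | h0
      · rw [← h0, zero_pow three_ne_zero]; positivity
      · have e1 := hloj t
        have e2 : a t ^ 3 * a t ≤ (C * √(g t)) * a t := by
          have : e t = a t ^ 3 * a t := by rw [← ha4 t]; ring
          rw [← this]; refine e1.trans_eq ?_; simp only [ha]; ring
        exact le_of_mul_le_mul_right e2 h0
    have h3 : κ * (√(g t) * √(g t)) ≤ 4 * (C * √(g t)) * (a t - a (t + 1)) := by
      rw [Real.mul_self_sqrt (hg t)]
      refine h1.trans ?_
      have := sub_nonneg.2 hxy
      gcongr
    rcases (Real.sqrt_nonneg (g t)).eq_or_lt with h0 | h0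
    · rw [← h0]; have := sub_nonneg.2 hxy; positivity
    · rw [div_mul_eq_mul_div, le_div_iff₀ hκ]
      have : (√(g t) * κ) * √(g t) ≤ (4 * C * (a t - a (t + 1))) * √(g t) := by linarith
      exact le_of_mul_le_mul_right this h0
  have hsum : Summable (fun t => √(g t)) := by
    refine summable_of_sum_range_le (c := 4 * C / κ * a 0) (fun t => Real.sqrt_nonneg _) fun n => ?_
    calc ∑ t ∈ Finset.range n, √(g t) ≤ ∑ t ∈ Finset.range n, 4 * C / κ * (a t - a (t + 1)) :=
          Finset.sum_le_sum fun t _ => hstep t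
      _ = 4 * C / κ * (a 0 - a n) := by rw [← Finset.mul_sum, Finset.sum_range_sub']
      _ ≤ 4 * C / κ * a 0 := by
          have := ha0 n
          gcongr; linarith
  refine ⟨hsum, squeeze_zero he (g := fun t => C * a 0 * √(g t)) (fun t => ?_) ?_⟩
  · refine (hloj t).trans ?_
    have : a t ≤ a 0 := antitone_nat_of_succ_le hanti (Nat.zero_le t)
    gcongr
  · simpa using hsum.tendsto_atTop_zero.const_mul (C * a 0)

/-! ### A single update: descent, step length and entropy. -/

namespace DualModel

variable {ι : Type*} [Fintype ι] {E : Type*} [NormedAddCommGroup E] [NormedSpace ℝ E]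
  {M : DualModel ι E}

/-- One hyperplane fixed point update. -/
structure IsStep (M : DualModel ι E) (ρ : ℝ) (lam : ι → ℝ) (mu : ℝ) (m : ι)
    (lam' : ι → ℝ) (mu' : ℝ) : Prop where
  worst : ∀ k, M.f m (M.w lam mu) ≤ M.f k (M.w lam mu)
  lam_ne : ∀ k, k ≠ m →
    lam' k = (M.f m (M.w lam mu) + ρ) / (M.f k (M.w lam mu) + ρ) * lam k
  lam_worst : lam' m = lam m +
    ∑ k, (1 - (M.f m (M.w lam mu) + ρ) / (M.f k (M.w lam mu) + ρ)) * lam k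
  mu_eq : mu' = (M.q (M.w lam mu) + ρ) / (M.P + ρ) * mu

/-- The weighted squared residual of the fixed point equations. -/
def residual (M : DualModel ι E) (lam : ι → ℝ) (mu : ℝ) (m : ι) : ℝ :=
  ∑ k, lam k * (M.f k (M.w lam mu) - M.f m (M.w lam mu)) ^ 2 +
    mu * (M.q (M.w lam mu) - M.P) ^ 2

theorem residual_nonneg {lam : ι → ℝ} {mu : ℝ} (hlam : ∀ k, 0 ≤ lam k) (hmu : 0 ≤ mu) (m : ι) :
    0 ≤ M.residual lam mu m :=
  add_nonneg (Finset.sum_nonneg fun k _ => mul_nonneg (hlam k) (sq_nonneg _))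
    (mul_nonneg hmu (sq_nonneg _))

variable {ρ B : ℝ} {lam lam' : ι → ℝ} {mu mu' : ℝ} {m : ι}

theorem sum_mul_sub_sq_le (hlam : lam ∈ M.simplex) (g : ι → ℝ) :
    (∑ k, lam k * g k) ^ 2 ≤ M.s * ∑ k, lam k * g k ^ 2 := by
  rw [← hlam.2]
  exact Finset.sum_sq_le_sum_mul_sum_of_sq_le_mul _ (fun k _ => hlam.1 k)
    (fun k _ => mul_nonneg (hlam.1 k) (sq_nonneg _)) fun k _ => le_of_eq (by ring)

/-- The update moves from each user `k` to `m` the fraction `(h k - h m) / (h k + ρ)` of `lam k`,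
which lies in `[0, 1]`. Pairing with the gradient makes the first-order change a negative sum of
squares with denominators at most `2 * ρ`. The step length is linear in the same differences, and
Cauchy–Schwarz against the weights `lam` bounds its square by the residual. -/
theorem IsStep.basic (hst : M.IsStep ρ lam mu m lam' mu') (hlam : lam ∈ M.simplex) (hmu : 0 < mu)
    (hB : 0 < B) (hf : ∀ k, |M.f k (M.w lam mu)| ≤ B) (hρB : 2 * B ≤ ρ)
    (hρP : M.P ≤ ρ) :
    lam' ∈ M.simplex ∧
    ∑ k, (lam' k - lam k) * M.f k (M.w lam mu) + (mu' - mu) * (M.P - M.q (M.w lam mu)) ≤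
      -(M.residual lam mu m / (2 * ρ)) ∧
    gapNorm lam lam' mu mu' ^ 2 ≤ (32 * M.s + 2 * mu) / ρ ^ 2 * M.residual lam mu m := by
  classical
  set h : ι → ℝ := fun k => M.f k (M.w lam mu) with hh
  set q := M.q (M.w lam mu) with hqdef
  have hP := M.P_pos
  have hρ : 0 < ρ := by linarith
  have hs : 0 ≤ M.s := by rw [← hlam.2]; exact Finset.sum_nonneg fun k _ => hlam.1 k
  have hlo : ∀ k, ρ / 2 ≤ h k + ρ := fun k => by have := (abs_le.1 (hf k)).1; simp only [hh]; linarith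
  have hhi : ∀ k, h k + ρ ≤ 2 * ρ := fun k => by have := (abs_le.1 (hf k)).2; simp only [hh]; linarith
  have hpos : ∀ k, 0 < h k + ρ := fun k => (half_pos hρ).trans_le (hlo k)
  have hd : ∀ k, 0 ≤ h k - h m := fun k => sub_nonneg.2 (hst.worst k)
  set a : ι → ℝ := fun k => 1 - (h m + ρ) / (h k + ρ) with ha
  have haeq : ∀ k, a k = (h k - h m) / (h k + ρ) := fun k => by
    simp only [ha]; rw [one_sub_div (hpos k).ne']; ring
  have ha0 : ∀ k, 0 ≤ a k := fun k => by rw [haeq]; exact div_nonneg (hd k) (hpos k).le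
  have ha1 : ∀ k, a k ≤ 1 := fun k => by
    have := div_nonneg (hpos m).le (hpos k).le
    simp only [ha]; linarith
  have ham : a m = 0 := by rw [haeq]; simp
  set T := ∑ k, a k * lam k with hT
  have hT0 : 0 ≤ T := Finset.sum_nonneg fun k _ => mul_nonneg (ha0 k) (hlam.1 k)
  have hΔ : ∀ k, lam' k - lam k = -(a k * lam k) + if k = m then T else 0 := by
    intro k
    split_ifs with hk
    · subst hk
      rw [hst.lam_worst, ham, zero_mul, neg_zero, zero_add, add_sub_cancel_left]
    · rw [hst.lam_ne k hk]; simp only [ha]; ring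
  have hmem : lam' ∈ M.simplex := by
    refine ⟨fun k => ?_, ?_⟩
    · have e1 := hΔ k
      have e2 : 0 ≤ (1 - a k) * lam k := mul_nonneg (sub_nonneg.2 (ha1 k)) (hlam.1 k)
      split_ifs at e1 <;> linarith
    · have e1 : ∑ k, (lam' k - lam k) = 0 := by
        simp only [hΔ, Finset.sum_add_distrib, Finset.sum_neg_distrib, Finset.sum_ite_eq',
          Finset.mem_univ, if_true]
        rw [← hT]; ring
      rw [Finset.sum_sub_distrib, hlam.2] at e1
      linarith
  have hx : mu' - mu = mu * (q - M.P) / (M.P + ρ) := by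
    rw [hst.mu_eq]; field_simp; ring
  have hPρ : 0 < M.P + ρ := by linarith
  set S := ∑ k, lam k * (h k - h m) ^ 2 with hS
  set R := mu * (q - M.P) ^ 2 with hR
  have hS0 : 0 ≤ S := Finset.sum_nonneg fun k _ => mul_nonneg (hlam.1 k) (sq_nonneg _)
  have hR0 : 0 ≤ R := by positivity
  have hres : M.residual lam mu m = S + R := rfl
  refine ⟨hmem, ?_, ?_⟩
  · have e1 : ∑ k, (lam' k - lam k) * h k ≤ -(S / (2 * ρ)) := by
      have e2 : ∑ k, (lam' k - lam k) * h k = -∑ k, a k * lam k * (h k - h m) := by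
        simp only [hΔ, add_mul, ite_mul, zero_mul, Finset.sum_add_distrib, Finset.sum_ite_eq',
          Finset.mem_univ, if_true, hT, Finset.sum_mul, mul_sub, Finset.sum_sub_distrib, neg_mul,
          Finset.sum_neg_distrib]
        ring
      rw [e2, neg_le_neg_iff, hS, Finset.sum_div]
      refine Finset.sum_le_sum fun k _ => ?_
      rw [haeq, show (h k - h m) / (h k + ρ) * lam k * (h k - h m) =
        lam k * (h k - h m) ^ 2 / (h k + ρ) by ring]
      exact div_le_div_of_nonneg_left (mul_nonneg (hlam.1 k) (sq_nonneg _)) (hpos k) (hhi k)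
    have e3 : (mu' - mu) * (M.P - q) ≤ -(R / (2 * ρ)) := by
      rw [hx, show mu * (q - M.P) / (M.P + ρ) * (M.P - q) = -(R / (M.P + ρ)) by rw [hR]; ring,
        neg_le_neg_iff]
      exact div_le_div_of_nonneg_left hR0 hPρ (by linarith)
    rw [hres, add_div]
    linarith
  · set S1 := ∑ k, lam k * (h k - h m) with hS1
    have hS10 : 0 ≤ S1 := Finset.sum_nonneg fun k _ => mul_nonneg (hlam.1 k) (hd k)
    have hTS : T ≤ 2 / ρ * S1 := by
      rw [hT, hS1, Finset.mul_sum]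
      refine Finset.sum_le_sum fun k _ => ?_
      rw [haeq]
      have : (h k - h m) / (h k + ρ) ≤ (h k - h m) / (ρ / 2) :=
        div_le_div_of_nonneg_left (hd k) (half_pos hρ) (hlo k)
      calc (h k - h m) / (h k + ρ) * lam k ≤ (h k - h m) / (ρ / 2) * lam k :=
            mul_le_mul_of_nonneg_right this (hlam.1 k)
        _ = _ := by field_simp
    have e1 : ∑ k, |lam' k - lam k| ≤ 4 / ρ * S1 := by
      calc ∑ k, |lam' k - lam k| ≤ ∑ k, (a k * lam k + if k = m then T else 0) := by
            refine Finset.sum_le_sum fun k _ => ?_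
            rw [hΔ]
            refine (abs_add_le _ _).trans (le_of_eq ?_)
            rw [abs_neg, abs_of_nonneg (mul_nonneg (ha0 k) (hlam.1 k)), abs_of_nonneg]
            split_ifs <;> [exact hT0; exact le_rfl]
        _ = 2 * T := by
            rw [Finset.sum_add_distrib, Finset.sum_ite_eq' Finset.univ m]
            simp only [Finset.mem_univ, if_true]; rw [← hT]; ring
        _ ≤ 2 * (2 / ρ * S1) := by linarith
        _ = _ := by ring
    have e2 : |mu' - mu| ≤ mu * |q - M.P| / ρ := by
      rw [hx, abs_div, abs_mul, abs_of_pos hmu, abs_of_pos hPρ]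
      exact div_le_div_of_nonneg_left (by positivity) hρ (by linarith)
    have e3 : gapNorm lam lam' mu mu' ≤ (4 * S1 + mu * |q - M.P|) / ρ := by
      rw [gapNorm, add_div]
      refine add_le_add (e1.trans_eq (by ring)) e2
    have e4 : S1 ^ 2 ≤ M.s * S := sum_mul_sub_sq_le hlam _
    calc gapNorm lam lam' mu mu' ^ 2 ≤ ((4 * S1 + mu * |q - M.P|) / ρ) ^ 2 :=
          pow_le_pow_left₀ (gapNorm_nonneg _ _ _ _) e3 2
      _ = (4 * S1 + mu * |q - M.P|) ^ 2 / ρ ^ 2 := by rw [div_pow]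
      _ ≤ ((32 * M.s + 2 * mu) * (S + R)) / ρ ^ 2 := by
          gcongr
          have e5 : (mu * |q - M.P|) ^ 2 = mu * R := by rw [mul_pow, sq_abs, hR]; ring
          have e6 : 0 ≤ M.s * R := mul_nonneg hs hR0
          have e7 : 0 ≤ mu * S := mul_nonneg hmu.le hS0
          nlinarith [sq_nonneg (4 * S1 - mu * |q - M.P|)]
      _ = _ := by rw [hres]; ring

/-- Both bounds come from `q ≥ 0`. The first keeps one update inside the region where smoothness is
known; the second, through `1 + P / ρ ≤ exp (P / ρ)`, gives a decay rate that stays bounded over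
`O(ρ)` updates. -/
theorem IsStep.mu_bounds (hst : M.IsStep ρ lam mu m lam' mu') (hmu : 0 < mu)
    (hρ : 0 < ρ) (hρP : M.P ≤ ρ) :
    mu / 2 ≤ mu' ∧ mu * Real.exp (-(M.P / ρ)) ≤ mu' := by
  have hP := M.P_pos
  have hPρ : 0 < M.P + ρ := by linarith
  have hq0 : 0 ≤ M.q (M.w lam mu) := (sq_nonneg _).trans (M.sq_norm_le_q _)
  have h1 : ρ / (M.P + ρ) * mu ≤ mu' := by
    rw [hst.mu_eq]; gcongr; linarith
  constructor
  · refine le_trans ?_ h1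
    have : 1 / 2 ≤ ρ / (M.P + ρ) := by rw [div_le_div_iff₀ two_pos hPρ]; linarith
    nlinarith
  · refine le_trans ?_ h1
    rw [mul_comm]
    gcongr
    rw [Real.exp_neg, inv_le_comm₀ (Real.exp_pos _) (by positivity), inv_div]
    have := Real.add_one_le_exp (M.P / ρ)
    rwa [add_div, div_self hρ.ne']

/-- The entropy-type potential for `mu` decreases when the first-order gap in `mu` is positive. -/
theorem IsStep.entropy (hst : M.IsStep ρ lam mu m lam' mu') {muS : ℝ} (hmu : 0 < mu)
    (hmuS : 0 < muS) (hB : 0 < B)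
    (hq : |M.q (M.w lam mu) - M.P| ≤ B) (hρB : 2 * B ≤ ρ) :
    (mu - muS) * (M.P - M.q (M.w lam mu)) ≤
      (M.P + ρ) * ((mu - muS * Real.log mu) - (mu' - muS * Real.log mu')) +
        2 * muS * B ^ 2 / ρ := by
  have hP := M.P_pos
  have hρ : 0 < ρ := by linarith
  have hPρ : 0 < M.P + ρ := by linarith
  set d := M.q (M.w lam mu) - M.P with hd
  set x := d / (M.P + ρ) with hx
  have hdx : d = (M.P + ρ) * x := by rw [hx]; field_simp
  have hx2 : |x| ≤ 1 / 2 := by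
    rw [hx, abs_div, abs_of_pos hPρ, div_le_div_iff₀ hPρ two_pos]; linarith
  have hmu' : mu' = (1 + x) * mu := by
    rw [hst.mu_eq, hx, hd]; field_simp; ring
  have hx1 : 1 / 2 ≤ 1 + x := by have := (abs_le.1 hx2).1; linarith
  -- The update of `mu` is multiplication by `1 + x`, so the logarithm contributes `x` up to an
  -- error of second order; `1 + x ≥ 1 / 2` provides the factor `2`.
  have hlog : x - 2 * x ^ 2 ≤ Real.log (1 + x) := by
    refine le_trans ?_ (Real.one_sub_inv_le_log_of_pos (by linarith))
    rw [show 1 - (1 + x)⁻¹ = x / (1 + x) by field_simp; ring, le_div_iff₀ (by linarith)]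
    nlinarith [mul_nonneg (sq_nonneg x) (by linarith : 0 ≤ 1 + x - 1 / 2)]
  have hlog' : Real.log mu' = Real.log (1 + x) + Real.log mu := by
    rw [hmu', Real.log_mul (by linarith) hmu.ne']
  have hdB : d ^ 2 ≤ B ^ 2 := sq_le_sq.2 (by rwa [abs_of_pos hB])
  have h1 : (M.P + ρ) * x ^ 2 ≤ B ^ 2 / ρ := by
    rw [hx, show (M.P + ρ) * (d / (M.P + ρ)) ^ 2 = d ^ 2 / (M.P + ρ) by field_simp]
    gcongr
    linarith
  have h2 := mul_le_mul_of_nonneg_left hlog (mul_nonneg hPρ.le hmuS.le)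
  have h3 := mul_le_mul_of_nonneg_left h1 hmuS.le
  rw [hlog', hmu', show M.P - M.q (M.w lam mu) = -((M.P + ρ) * x) by rw [← hdx, hd]; ring,
    show 2 * muS * B ^ 2 / ρ = 2 * (muS * (B ^ 2 / ρ)) by ring]
  linarith

theorem sum_sub_mul_eq {lam lam' : ι → ℝ} (hlam : lam ∈ M.simplex) (hlam' : lam' ∈ M.simplex)
    (g : ι → ℝ) (c : ℝ) :
    ∑ k, (lam k - lam' k) * g k = ∑ k, (lam k - lam' k) * (g k - c) := by
  simp only [mul_sub, Finset.sum_sub_distrib, ← Finset.sum_mul, hlam.2, hlam'.2]; ring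

/-- Convexity of the dual function along a step: the excess is bounded by the first-order gap. -/
theorem dual_sub_le_first_order {W₀ : ℝ} (hlam : lam ∈ M.simplex) (hlam' : lam' ∈ M.simplex)
    (hW : ∀ W, M.lag W lam' mu' ≤ W₀) (c : ℝ) :
    M.dual lam mu - W₀ ≤ ∑ k, (lam k - lam' k) * (M.f k (M.w lam mu) - c) +
      (mu - mu') * (M.P - M.q (M.w lam mu)) := by
  -- The bound `W₀` on the Lagrangian stands in for a dual value at `(lam', mu')`, because `mu'` may
  -- be zero, where nothing is known of `M.w`.
  have h1 := hW (M.w lam mu)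
  have h2 := dual_sub_lag_eq (M := M) (lam := lam) (lam' := lam') (mu := mu) (mu' := mu')
  rw [sum_sub_mul_eq hlam hlam' _ c] at h2
  linarith

end DualModel

/-! ### Choice of `ρ`, the Łojasiewicz inequality and convergence. -/

namespace DualModel

variable {ι : Type*} [Fintype ι] {E : Type*} [NormedAddCommGroup E] [NormedSpace ℝ E]
  {M : DualModel ι E}

/-- With a large enough constant, one update from `mu ≥ 2 mu1` is a descent step. -/
theorem exists_descent_constant (M : DualModel ι E) {mu1 mu2 muS ε : ℝ} (hmu1 : 0 < mu1)
    (hmu2 : 0 ≤ mu2) (hmuS : 0 < muS) (hε : 0 < ε) (hs : 0 ≤ M.s) :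
    ∃ ρ, M.P ≤ ρ ∧ ∃ c, 0 ≤ c ∧ ∀ lam mu m lam' mu', lam ∈ M.simplex → 2 * mu1 ≤ mu → mu ≤ mu2 →
      M.IsStep ρ lam mu m lam' mu' →
      (∀ k, 0 < M.f k (M.w lam mu) + ρ) ∧ lam' ∈ M.simplex ∧ mu1 ≤ mu' ∧
      mu * Real.exp (-(M.P / ρ)) ≤ mu' ∧
      M.dual lam' mu' ≤ M.dual lam mu - 1 / (4 * ρ) * M.residual lam mu m ∧
      gapNorm lam lam' mu mu' ^ 2 ≤ c * M.residual lam mu m ∧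
      (mu - muS) * (M.P - M.q (M.w lam mu)) ≤
        (M.P + ρ) * ((mu - muS * Real.log mu) - (mu' - muS * Real.log mu')) + ε := by
  obtain ⟨B, hB, hbd⟩ := M.exists_bound hmu1
  obtain ⟨Λ, hΛ, hsm⟩ := M.exists_smooth hmu1
  have hP := M.P_pos
  set N := 32 * M.s + 2 * mu2 with hN
  have hN0 : 0 ≤ N := by positivity
  -- One summand per requirement: positive denominators with two-sided bounds, `P ≤ ρ`, the
  -- quadratic error of the descent inequality below half of the first-order decrease, and the
  -- entropy error below `ε`.
  set ρ := 2 * B + M.P + 4 * (Λ * N) + 2 * muS * B ^ 2 / ε with hρdef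
  have t1 : 0 ≤ 2 * muS * B ^ 2 / ε := by positivity
  have t2 : 0 ≤ 4 * (Λ * N) := by positivity
  have hρB : 2 * B ≤ ρ := by linarith
  have hρP : M.P ≤ ρ := by linarith
  have hρ : 0 < ρ := by linarith
  refine ⟨ρ, hρP, N / ρ ^ 2, by positivity, fun lam mu m lam' mu' hlam hmu hmu2 hst => ?_⟩
  have hmu0 : 0 < mu := by linarith
  obtain ⟨-, hf, hq⟩ := hbd lam mu hlam (by linarith)
  obtain ⟨hmem, hfo, hgap⟩ := hst.basic hlam hmu0 hB hf hρB hρP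
  obtain ⟨hb1, hb2⟩ := hst.mu_bounds hmu0 hρ hρP
  have hent := hst.entropy hmu0 hmuS hB hq hρB
  have hres := residual_nonneg (M := M) hlam.1 hmu0.le m
  have hmu1' : mu1 ≤ mu' := by linarith
  have hgap' : gapNorm lam lam' mu mu' ^ 2 ≤ N / ρ ^ 2 * M.residual lam mu m :=
    hgap.trans (by simp only [hN]; gcongr)
  refine ⟨fun k => ?_, hmem, hmu1', hb2, ?_, hgap', hent.trans ?_⟩
  · have := (abs_le.1 (hf k)).1; linarith
  · have h1 := hsm lam mu lam' mu' hlam (by linarith) hmem hmu1'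
    have h2 := mul_le_mul_of_nonneg_left hgap' hΛ
    have h3 : Λ * (N / ρ ^ 2 * M.residual lam mu m) ≤ 1 / (4 * ρ) * M.residual lam mu m := by
      rw [← mul_assoc]
      gcongr
      rw [← mul_div_assoc, div_le_div_iff₀ (by positivity) (by positivity)]
      nlinarith
    have h4 : M.residual lam mu m / (2 * ρ) = 2 * (1 / (4 * ρ) * M.residual lam mu m) := by
      field_simp; ring
    linarith
  · have : 2 * muS * B ^ 2 / ρ ≤ ε := by
      rw [div_le_iff₀ hρ, ← div_le_iff₀' hε]; linarith
    linarith

variable {lamS : ι → ℝ} {muS : ℝ}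

theorem exists_mu_le (M : DualModel ι E) (D : ℝ) :
    ∃ mu2, ∀ lam mu, lam ∈ M.simplex → 0 < mu → M.dual lam mu ≤ D → mu ≤ mu2 := by
  obtain ⟨A, hA⟩ := M.exists_lag_zero_ge
  refine ⟨(D + A) / M.P, fun lam mu hlam hmu hD => ?_⟩
  have h1 := hA lam mu hlam
  have h2 := lag_le_dual (M := M) hlam.1 hmu 0
  rw [le_div_iff₀ M.P_pos]
  linarith

/-- Dropping `lamS` is harmless since all differences from the worst rate are nonnegative.
Cauchy–Schwarz and `2 * a * b ≤ a ^ 2 + b ^ 2` then split the sum into a tolerance and a multiple of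
the residual. -/
theorem sum_first_order_le {lam : ι → ℝ} {mu : ℝ} {m : ι} (hlam : lam ∈ M.simplex)
    (hlamS : lamS ∈ M.simplex) (hm : ∀ k, M.f m (M.w lam mu) ≤ M.f k (M.w lam mu)) (hmu : 0 < mu)
    {ε : ℝ} (hε : 0 < ε) :
    ∑ k, (lam k - lamS k) * (M.f k (M.w lam mu) - M.f m (M.w lam mu)) ≤
      ε / 4 + M.s / ε * M.residual lam mu m := by
  have hs : 0 ≤ M.s := by rw [← hlam.2]; exact Finset.sum_nonneg fun k _ => hlam.1 k
  set g : ι → ℝ := fun k => M.f k (M.w lam mu) - M.f m (M.w lam mu) with hg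
  have hg0 : ∀ k, 0 ≤ g k := fun k => sub_nonneg.2 (hm k)
  have h1 : ∑ k, (lam k - lamS k) * g k ≤ ∑ k, lam k * g k :=
    Finset.sum_le_sum fun k _ => mul_le_mul_of_nonneg_right
      (sub_le_self _ (hlamS.1 k)) (hg0 k)
  have h2 := sum_mul_sub_sq_le hlam g
  have h3 : ∑ k, lam k * g k ^ 2 ≤ M.residual lam mu m :=
    le_add_of_nonneg_right (mul_nonneg hmu.le (sq_nonneg _))
  refine h1.trans ?_
  have h4 : (∑ k, lam k * g k) ^ 2 ≤ M.s * M.residual lam mu m :=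
    h2.trans (mul_le_mul_of_nonneg_left h3 hs)
  rw [div_mul_eq_mul_div, ← sub_le_iff_le_add', le_div_iff₀ hε]
  nlinarith [sq_nonneg (∑ k, lam k * g k - ε / 2)]

/-- A Łojasiewicz inequality with exponent `3/4` for the dual function, in terms of the residual of
the fixed point iteration. -/
theorem IsMinimizer.exists_lojasiewicz (h : M.IsMinimizer lamS muS) {mu1 : ℝ} (hmu1 : 0 < mu1)
    (mu2 e : ℝ) :
    ∃ C, 0 ≤ C ∧ ∀ lam mu m, lam ∈ M.simplex → mu1 ≤ mu → mu ≤ mu2 →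
      M.dual lam mu ≤ M.dual lamS muS + e →
      (∀ k, M.f m (M.w lam mu) ≤ M.f k (M.w lam mu)) →
      M.dual lam mu - M.dual lamS muS ≤
        C * √√(M.dual lam mu - M.dual lamS muS) * √(M.residual lam mu m) := by
  obtain ⟨C, hC, heb⟩ := h.exists_error_bound mu2 e
  set c3 := C * √e / mu1 with hc3
  have hc30 : 0 ≤ c3 := by positivity
  refine ⟨(Fintype.card ι + √c3) * √C, by positivity, fun lam mu m hlam hmu hmu2 hD hm => ?_⟩
  have hmu0 : 0 < mu := hmu1.trans_le hmu
  obtain ⟨lamP, muP, hlamP, hmuP, hW, hgap⟩ := heb lam mu hlam hmu0 hmu2 hD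
  have hfo := dual_sub_le_first_order (lam := lam) (mu := mu) hlam hlamP hW (M.f m (M.w lam mu))
  set D := M.dual lam mu - M.dual lamS muS with hDdef
  set Γ := M.residual lam mu m with hΓ
  set δ := gapNorm lam lamP mu muP with hδ
  have hδ0 : 0 ≤ δ := gapNorm_nonneg _ _ _ _
  have hΓ0 : 0 ≤ Γ := residual_nonneg hlam.1 hmu0.le m
  set g : ι → ℝ := fun k => M.f k (M.w lam mu) - M.f m (M.w lam mu) with hg
  have hg0 : ∀ k, 0 ≤ g k := fun k => sub_nonneg.2 (hm k)
  have hδk : ∀ k, |lamP k - lam k| ≤ δ := fun k =>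
    (Finset.single_le_sum (f := fun k => |lamP k - lam k|) (fun j _ => abs_nonneg _)
      (Finset.mem_univ k)).trans (le_add_of_nonneg_right (abs_nonneg _))
  have hδmu : |muP - mu| ≤ δ :=
    le_add_of_nonneg_left (Finset.sum_nonneg fun k _ => abs_nonneg _)
  have hΓk : ∀ k, lam k * g k ^ 2 ≤ Γ := fun k =>
    (Finset.single_le_sum (f := fun k => lam k * g k ^ 2)
      (fun j _ => mul_nonneg (hlam.1 j) (sq_nonneg _))
      (Finset.mem_univ k)).trans (le_add_of_nonneg_right (mul_nonneg hmu0.le (sq_nonneg _)))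
  have hΓmu : mu * (M.q (M.w lam mu) - M.P) ^ 2 ≤ Γ :=
    le_add_of_nonneg_left (Finset.sum_nonneg fun k _ => mul_nonneg (hlam.1 k) (sq_nonneg _))
  -- Only users with `lam k > lamP k` matter, and then `lam k - lamP k` is at most both `δ` and `lam
  -- k`. One factor of each is used, because the residual carries the weight `lam k`; with `δ =
  -- O(√D)` this yields the exponent `3/4`.
  have hk : ∀ k, (lam k - lamP k) * g k ≤ √(δ * Γ) := by
    intro k
    rcases le_total (lam k) (lamP k) with hle | hle
    · exact (mul_nonpos_of_nonpos_of_nonneg (sub_nonpos.2 hle) (hg0 k)).trans (Real.sqrt_nonneg _)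
    · refine Real.le_sqrt_of_sq_le ?_
      have e0 := sub_nonneg.2 hle
      have e1 : lam k - lamP k ≤ δ := by
        have := hδk k; rw [abs_sub_comm, abs_of_nonneg e0] at this; exact this
      have e2 : lam k - lamP k ≤ lam k := sub_le_self _ (hlamP.1 k)
      calc ((lam k - lamP k) * g k) ^ 2 = (lam k - lamP k) * ((lam k - lamP k) * g k ^ 2) := by ring
        _ ≤ δ * (lam k * g k ^ 2) := by gcongr
        _ ≤ δ * Γ := by gcongr; exact hΓk k
  have hmuterm : (mu - muP) * (M.P - M.q (M.w lam mu)) ≤ √c3 * √(δ * Γ) := by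
    rw [← Real.sqrt_mul hc30]
    refine Real.le_sqrt_of_sq_le ?_
    have e1 : (mu - muP) ^ 2 ≤ δ ^ 2 := sq_le_sq.2 (by rwa [abs_sub_comm, abs_of_nonneg hδ0])
    have e2 : δ ≤ C * √e := hgap.trans (by gcongr; linarith)
    have e3 : mu1 * (M.q (M.w lam mu) - M.P) ^ 2 ≤ Γ := le_trans (by gcongr) hΓmu
    calc ((mu - muP) * (M.P - M.q (M.w lam mu))) ^ 2
        = (mu - muP) ^ 2 * (M.q (M.w lam mu) - M.P) ^ 2 := by ring
      _ ≤ δ ^ 2 * (Γ / mu1) := by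
          gcongr
          rwa [le_div_iff₀' hmu1]
      _ = δ * (δ * (Γ / mu1)) := by ring
      _ ≤ (C * √e) * (δ * (Γ / mu1)) := by gcongr
      _ = c3 * (δ * Γ) := by rw [hc3]; ring
  have hsum : ∑ k, (lam k - lamP k) * g k ≤ Fintype.card ι * √(δ * Γ) := by
    refine (Finset.sum_le_sum fun k _ => hk k).trans_eq ?_
    rw [Finset.sum_const, Finset.card_univ, nsmul_eq_mul]
  have hfin : √(δ * Γ) ≤ √C * √√D * √Γ := by
    rw [← Real.sqrt_mul hC, ← Real.sqrt_mul (by positivity)]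
    gcongr
  calc D ≤ Fintype.card ι * √(δ * Γ) + √c3 * √(δ * Γ) := by linarith
    _ = (Fintype.card ι + √c3) * √(δ * Γ) := by ring
    _ ≤ (Fintype.card ι + √c3) * (√C * √√D * √Γ) := by gcongr
    _ = _ := by ring

/-- Convergence of the hyperplane fixed point iteration to a minimiser of the dual function. -/
theorem IsMinimizer.exists_converges (h : M.IsMinimizer lamS muS) {ε ν : ℝ} (hε : 0 < ε)
    (hν : 0 < ν) (hsub : ∀ lam mu, lam ∈ M.simplex → 0 < mu →
      M.dual lam mu ≤ M.dual lamS muS + ε → ν ≤ mu)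
    {lam0 : ι → ℝ} {mu0 : ℝ} (hlam0 : lam0 ∈ M.simplex) (hmu0 : 0 < mu0) :
    ∃ ρ, 0 ≤ ρ ∧ ∀ (lam : ℕ → ι → ℝ) (mu : ℕ → ℝ), lam 0 = lam0 → mu 0 = mu0 →
      (∀ t, ∃ m, M.IsStep ρ (lam t) (mu t) m (lam (t + 1)) (mu (t + 1))) →
      (∀ t k, 0 < M.f k (M.w (lam t) (mu t)) + ρ) ∧
      ∃ lamL muL, lamL ∈ M.simplex ∧ 0 < muL ∧ (∀ W, M.lag W lamL muL ≤ M.dual lamS muS) ∧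
        Tendsto lam atTop (𝓝 lamL) ∧ Tendsto mu atTop (𝓝 muL) := by
  have hP := M.P_pos
  have hs : 0 ≤ M.s := by rw [← hlam0.2]; exact Finset.sum_nonneg fun k _ => hlam0.1 k
  set D0 := M.dual lam0 mu0 with hD0
  set Ds := M.dual lamS muS with hDs
  set V : ℝ → ℝ := fun x => x - muS * Real.log x with hV
  have hVmin : ∀ x, 0 < x → V muS ≤ V x := by
    intro x hx
    have e1 := Real.log_le_sub_one_of_pos (div_pos hx h.pos)
    rw [Real.log_div hx.ne' h.pos.ne'] at e1
    have e2 := mul_le_mul_of_nonneg_left e1 h.pos.le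
    rw [mul_sub, mul_sub, mul_div_cancel₀ _ h.pos.ne'] at e2
    simp only [hV]; linarith
  have hD0s : Ds ≤ D0 := h.le _ _ hlam0 hmu0
  -- `ρ * X` bounds the total possible drop of the potential, using `P + ρ ≤ 2 * ρ`; `X` itself does
  -- not involve `ρ`.
  set X := 4 * M.s / ε * (D0 - Ds) + 2 * (V mu0 - V muS) with hX
  have hX0 : 0 ≤ X := by
    have := hVmin mu0 hmu0
    have : 0 ≤ 4 * M.s / ε * (D0 - Ds) := by
      have := sub_nonneg.2 hD0s
      positivity
    linarith
  obtain ⟨mu2, hmu2⟩ := M.exists_mu_le D0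
  have hmu20 : 0 ≤ mu2 := hmu0.le.trans (hmu2 _ _ hlam0 hmu0 le_rfl)
  -- The exponential is the decay over at most `2 * ρ * X / ε` updates, with `ρ` cancelled. Iterates
  -- stay above `2 * mu1`; the halving leaves room for one update before the invariant is
  -- re-established.
  set mu1 := min ν (mu0 * Real.exp (-(2 * X * M.P / ε))) / 2 with hmu1def
  have hmu1 : 0 < mu1 := by have := Real.exp_pos (-(2 * X * M.P / ε)); positivity
  have h2mu1 : 2 * mu1 = min ν (mu0 * Real.exp (-(2 * X * M.P / ε))) := by rw [hmu1def]; ring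
  obtain ⟨ρ, hρP, c, hc, hstep⟩ := M.exists_descent_constant hmu1 hmu20 h.pos
    (by positivity : 0 < ε / 4) hs
  have hρ : 0 < ρ := hP.trans_le hρP
  obtain ⟨C, hC, hloj⟩ := h.exists_lojasiewicz hmu1 mu2 (D0 - Ds)
  refine ⟨ρ, hρ.le, fun lam mu hl0 hm0 hit => ?_⟩
  choose m hit using hit
  -- the invariant: either near the minimum, or the potential has dropped at a constant rate
  have hinv : ∀ t : ℕ, lam t ∈ M.simplex ∧ 2 * mu1 ≤ mu t ∧ M.dual (lam t) (mu t) ≤ D0 ∧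
      (M.dual (lam t) (mu t) ≤ Ds + ε ∨
        (4 * M.s * ρ / ε * M.dual (lam t) (mu t) + (M.P + ρ) * V (mu t) + t * (ε / 2) ≤
          4 * M.s * ρ / ε * D0 + (M.P + ρ) * V mu0 ∧
        mu0 * Real.exp (-(M.P / ρ * t)) ≤ mu t)) := by
    intro t
    induction t with
    | zero =>
      rw [hl0, hm0]
      refine ⟨hlam0, ?_, le_rfl, Or.inr ⟨by simp [hD0], by simp⟩⟩
      rw [h2mu1]
      refine (min_le_right _ _).trans (mul_le_of_le_one_right hmu0.le (Real.exp_le_one_iff.2 ?_))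
      have : 0 ≤ 2 * X * M.P / ε := by positivity
      linarith
    | succ t ih =>
      obtain ⟨il, imu, iD, ior⟩ := ih
      have imu0 : 0 < mu t := by linarith
      obtain ⟨-, sl, smu1, sexp, sdesc, -, sent⟩ :=
        hstep _ _ _ _ _ il imu (hmu2 _ _ il imu0 iD) (hit t)
      have smu0 : 0 < mu (t + 1) := hmu1.trans_le smu1
      have hres := residual_nonneg (M := M) il.1 imu0.le (m t)
      have hres' : 0 ≤ 1 / (4 * ρ) * M.residual (lam t) (mu t) (m t) := by positivity
      have sD : M.dual (lam (t + 1)) (mu (t + 1)) ≤ M.dual (lam t) (mu t) := by linarith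
      have sDs := h.le _ _ sl smu0
      by_cases hnear : M.dual (lam (t + 1)) (mu (t + 1)) ≤ Ds + ε
      · exact ⟨sl, (h2mu1.trans_le (min_le_left _ _)).trans (hsub _ _ sl smu0 hnear),
          sD.trans iD, Or.inl hnear⟩
      have hfar : Ds + ε < M.dual (lam t) (mu t) := (not_le.1 hnear).trans_le sD
      obtain ⟨ipot, iexp⟩ := ior.resolve_left (not_le.2 hfar)
      -- The gap before the update exceeds `ε`. By convexity it is at most two errors of `ε / 4`,
      -- plus a residual term paid for by the dual descent, plus the entropy decrease; hence the
      -- potential drops by at least `ε / 2`.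
      have hpot : 4 * M.s * ρ / ε * M.dual (lam (t + 1)) (mu (t + 1)) +
          (M.P + ρ) * V (mu (t + 1)) + (t + 1 : ℕ) * (ε / 2) ≤
          4 * M.s * ρ / ε * D0 + (M.P + ρ) * V mu0 := by
        have e1 := dual_sub_le_first_order (mu := mu t) il h.mem
          (fun W => lag_le_dual h.mem.1 h.pos W) (M.f (m t) (M.w (lam t) (mu t)))
        have e2 := sum_first_order_le il h.mem (hit t).worst imu0 hε
        have e3 : M.s / ε * M.residual (lam t) (mu t) (m t) ≤
            4 * M.s * ρ / ε * (M.dual (lam t) (mu t) - M.dual (lam (t + 1)) (mu (t + 1))) := by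
          have : M.residual (lam t) (mu t) (m t) ≤
              4 * ρ * (M.dual (lam t) (mu t) - M.dual (lam (t + 1)) (mu (t + 1))) := by
            rw [← div_le_iff₀' (by positivity), div_eq_inv_mul, inv_eq_one_div]
            linarith
          calc _ ≤ M.s / ε * (4 * ρ * _) := mul_le_mul_of_nonneg_left this (by positivity)
            _ = _ := by ring
        push_cast
        simp only [hV] at ipot ⊢
        linarith
      have hexp : mu0 * Real.exp (-(M.P / ρ * (t + 1 : ℕ))) ≤ mu (t + 1) := by
        refine le_trans ?_ sexp
        rw [show -(M.P / ρ * (t + 1 : ℕ)) = -(M.P / ρ * t) + -(M.P / ρ) by push_cast; ring,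
          Real.exp_add, ← mul_assoc]
        gcongr
      refine ⟨sl, ?_, sD.trans iD, Or.inr ⟨hpot, hexp⟩⟩
      rw [h2mu1]
      refine (min_le_right _ _).trans (le_trans ?_ hexp)
      gcongr
      have e1 := hVmin _ smu0
      have e2 : 4 * M.s * ρ / ε * Ds ≤ 4 * M.s * ρ / ε * M.dual (lam (t + 1)) (mu (t + 1)) := by
        gcongr
      have e3 : (M.P + ρ) * V muS ≤ (M.P + ρ) * V (mu (t + 1)) := by gcongr
      have e4 : (M.P + ρ) * (V mu0 - V muS) ≤ 2 * ρ * (V mu0 - V muS) :=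
        mul_le_mul_of_nonneg_right (by linarith) (sub_nonneg.2 (hVmin mu0 hmu0))
      have e5 : ρ * X = 4 * M.s * ρ / ε * (D0 - Ds) + 2 * ρ * (V mu0 - V muS) := by
        rw [hX]; ring
      have e6 : ((t + 1 : ℕ) : ℝ) * (ε / 2) ≤ ρ * X := by linarith
      rw [div_mul_eq_mul_div, div_le_div_iff₀ hρ hε]
      have := mul_le_mul_of_nonneg_left e6 hP.le
      linarith
  have hmu0' : ∀ t, 0 < mu t := fun t => by have := (hinv t).2.1; linarith
  have hst := fun t => hstep _ _ _ _ _ (hinv t).1 (hinv t).2.1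
    (hmu2 _ _ (hinv t).1 (hmu0' t) (hinv t).2.2.1) (hit t)
  refine ⟨fun t => (hst t).1, ?_⟩
  have hres : ∀ t, 0 ≤ M.residual (lam t) (mu t) (m t) := fun t =>
    residual_nonneg (hinv t).1.1 (hmu0' t).le _
  -- The step lengths are at most `√c * √residual`, so summability here makes both multiplier
  -- sequences Cauchy.
  obtain ⟨hsum, hlim⟩ := summable_sqrt_of_descent (κ := 1 / (4 * ρ)) (by positivity) hC
    (e := fun t => M.dual (lam t) (mu t) - Ds)
    (fun t => sub_nonneg.2 (h.le _ _ (hinv t).1 (hmu0' t))) hres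
    (fun t => by have := (hst t).2.2.2.2.1; linarith)
    (fun t => hloj _ _ _ (hinv t).1 (by have := (hinv t).2.1; linarith)
      (hmu2 _ _ (hinv t).1 (hmu0' t) (hinv t).2.2.1)
      (by have := (hinv t).2.2.1; linarith) (hit t).worst)
  have hgap : ∀ t, gapNorm (lam t) (lam (t + 1)) (mu t) (mu (t + 1)) ≤
      √c * √(M.residual (lam t) (mu t) (m t)) := fun t => by
    rw [← Real.sqrt_mul hc]
    exact Real.le_sqrt_of_sq_le (hst t).2.2.2.2.2.1
  have hsum' := hsum.mul_left √c
  have hcl : CauchySeq lam := cauchySeq_of_dist_le_of_summable _ (fun t => by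
    refine (dist_pi_le_iff (by positivity)).2 fun k => ?_
    rw [dist_comm, Real.dist_eq]
    exact ((Finset.single_le_sum (f := fun k => |lam (t + 1) k - lam t k|)
      (fun j _ => abs_nonneg _) (Finset.mem_univ k)).trans
      (le_add_of_nonneg_right (abs_nonneg _))).trans (hgap t)) hsum'
  have hcm : CauchySeq mu := cauchySeq_of_dist_le_of_summable _ (fun t => by
    rw [dist_comm, Real.dist_eq]
    exact (le_add_of_nonneg_left (Finset.sum_nonneg fun k _ => abs_nonneg _)).trans (hgap t)) hsum'
  obtain ⟨lamL, hlamL⟩ := cauchySeq_tendsto_of_complete hcl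
  obtain ⟨muL, hmuL⟩ := cauchySeq_tendsto_of_complete hcm
  have hcoord : ∀ k, Tendsto (fun t => lam t k) atTop (𝓝 (lamL k)) := tendsto_pi_nhds.1 hlamL
  refine ⟨lamL, muL, ⟨fun k => ge_of_tendsto' (hcoord k) fun t => (hinv t).1.1 k, ?_⟩,
    (by positivity : 0 < 2 * mu1).trans_le (ge_of_tendsto' hmuL fun t => (hinv t).2.1),
    fun W => ?_, hlamL, hmuL⟩
  · refine tendsto_nhds_unique (tendsto_finsetSum _ fun k _ => hcoord k) ?_
    simp only [(hinv _).1.2]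
    exact tendsto_const_nhds
  · have e1 : Tendsto (fun t => M.lag W (lam t) (mu t)) atTop (𝓝 (M.lag W lamL muL)) :=
      ((tendsto_finsetSum _ fun k _ => (hcoord k).mul_const (M.f k W)).const_add _).sub
        (hmuL.mul_const _)
    have e2 : Tendsto (fun t => M.dual (lam t) (mu t)) atTop (𝓝 Ds) := by
      simpa using hlim.add_const Ds
    exact le_of_tendsto_of_tendsto' e1 e2 fun t => lag_le_dual (hinv t).1.1 (hmu0' t) W

end DualModel

-- The beamforming problem as an instance of the abstract model.

attribute [local instance] Matrix.frobeniusNormedAddCommGroup Matrix.frobeniusNormedSpace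

namespace Subproblem

variable {K L : ℕ} (S : Subproblem K L)

theorem power_eq_sum (W : Matrix (Fin L) (Fin (K + 1)) ℂ) :
    power W = ∑ l, ∑ i, ‖W l i‖ ^ 2 := by
  simp only [power, Matrix.trace, Matrix.diag, Matrix.mul_apply, Matrix.conjTranspose_apply,
    Complex.re_sum]
  refine Finset.sum_congr rfl fun l _ => Finset.sum_congr rfl fun i _ => ?_
  rw [Complex.star_def, Complex.mul_conj, Complex.ofReal_re, Complex.normSq_eq_norm_sq]

theorem power_eq_norm_sq (W : Matrix (Fin L) (Fin (K + 1)) ℂ) : power W = ‖W‖ ^ 2 := by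
  rw [power_eq_sum, Matrix.frobenius_norm_def, ← Real.sqrt_eq_rpow, Real.sq_sqrt (by positivity)]
  simp

/-- The map `W ↦ h_kᴴ w_i` as a real continuous linear map. -/
def gainL (k : Fin K) (i : Fin (K + 1)) : Matrix (Fin L) (Fin (K + 1)) ℂ →L[ℝ] ℂ :=
  LinearMap.toContinuousLinearMap
    { toFun := fun W => S.gain W k i
      map_add' := fun V W => by simp [gain, dotProduct, Matrix.col, mul_add, Finset.sum_add_distrib]
      map_smul' := fun a W => by
        simp only [gain, dotProduct, Matrix.col, Matrix.transpose_apply, Matrix.smul_apply,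
          RingHom.id_apply, Finset.smul_sum, mul_smul_comm] }

/-- The map `W ↦ W l i` as a real continuous linear map. -/
def entryL (l : Fin L) (i : Fin (K + 1)) : Matrix (Fin L) (Fin (K + 1)) ℂ →L[ℝ] ℂ :=
  LinearMap.toContinuousLinearMap (Matrix.entryLinearMap ℝ ℂ l i)

theorem isConcaveQuadratic_neg_power :
    IsConcaveQuadratic fun W : Matrix (Fin L) (Fin (K + 1)) ℂ => -power W := by
  have := IsConcaveQuadratic.sum Finset.univ fun l : Fin L =>
    IsConcaveQuadratic.sum Finset.univ fun i : Fin (K + 1) =>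
      IsConcaveQuadratic.neg_norm_sq (entryL l i)
  convert this using 2 with W
  change -power W = ∑ l, ∑ i, -‖W l i‖ ^ 2
  simp only [power_eq_sum, Finset.sum_neg_distrib]

/-- A rate-type function is concave quadratic. -/
theorem isConcaveQuadratic_rate {J : Type*} (s : Finset J) (k : Fin K) (i : Fin (K + 1))
    (j : J → Fin (K + 1)) (a c n : ℝ) (b : ℂ) :
    IsConcaveQuadratic fun W : Matrix (Fin L) (Fin (K + 1)) ℂ =>
      2 * a * (star b * S.gain W k i).re - c - ‖b‖ ^ 2 * ((∑ x ∈ s, ‖S.gain W k (j x)‖ ^ 2) + n)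
        + Real.log (1 + c) := by
  have h1 := IsConcaveQuadratic.linear
    ((2 * a) • (Complex.reCLM.comp ((ContinuousLinearMap.mul ℝ ℂ (star b)).comp (S.gainL k i))))
  have h2 := (IsConcaveQuadratic.sum s fun x =>
    IsConcaveQuadratic.neg_norm_sq (S.gainL k (j x))).const_mul (sq_nonneg ‖b‖)
  have h3 := (h1.add h2).add
    (IsConcaveQuadratic.const (-c - ‖b‖ ^ 2 * n + Real.log (1 + c)))
  convert h3 using 2 with W
  change _ = 2 * a * (star b * S.gain W k i).re + ‖b‖ ^ 2 * ∑ x ∈ s, -‖S.gain W k (j x)‖ ^ 2 + _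
  rw [Finset.sum_neg_distrib]
  ring

theorem isConcaveQuadratic_gCommon (k : Fin K) : IsConcaveQuadratic fun W => S.gCommon W k :=
  S.isConcaveQuadratic_rate Finset.univ k 0 id _ _ _ _

theorem isConcaveQuadratic_gPrivate (k : Fin K) : IsConcaveQuadratic fun W => S.gPrivate W k :=
  S.isConcaveQuadratic_rate Finset.univ k k.succ Fin.succ _ _ _ _

/-- Completing the square: `2 * √(1 + α) * ‖b‖ * ‖x‖ - ‖b‖ ^ 2 * ‖x‖ ^ 2` is at most `1 + α`, and
the `-α` cancels. -/
theorem rate_le {α n T : ℝ} (hα : 0 ≤ α) (hn : 0 < n) (b x : ℂ) (hT : ‖x‖ ^ 2 ≤ T) :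
    2 * √(1 + α) * (star b * x).re - α - ‖b‖ ^ 2 * (T + n) + Real.log (1 + α) ≤
      1 + Real.log (1 + α) := by
  have h1 : (star b * x).re ≤ ‖b‖ * ‖x‖ := by
    refine (Complex.re_le_norm _).trans_eq ?_
    rw [norm_mul, norm_star]
  have h2 : √(1 + α) ^ 2 = 1 + α := Real.sq_sqrt (by linarith)
  have h3 := mul_le_mul_of_nonneg_left h1 (Real.sqrt_nonneg (1 + α))
  have h4 : ‖b‖ ^ 2 * ‖x‖ ^ 2 ≤ ‖b‖ ^ 2 * (T + n) := by gcongr; linarith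
  nlinarith [sq_nonneg (√(1 + α) - ‖b‖ * ‖x‖)]

theorem gCommon_le (W : Matrix (Fin L) (Fin (K + 1)) ℂ) (k : Fin K) :
    S.gCommon W k ≤ 1 + Real.log (1 + S.αc k) :=
  rate_le (S.αc_nonneg k) (S.noise_pos k) _ _
    (Finset.single_le_sum (f := fun j => ‖S.gain W k j‖ ^ 2) (fun _ _ => sq_nonneg _)
      (Finset.mem_univ 0))

theorem gPrivate_le (W : Matrix (Fin L) (Fin (K + 1)) ℂ) (k : Fin K) :
    S.gPrivate W k ≤ 1 + Real.log (1 + S.αp k) :=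
  rate_le (S.αp_nonneg k) (S.noise_pos k) _ _
    (Finset.single_le_sum (f := fun j : Fin K => ‖S.gain W k j.succ‖ ^ 2) (fun _ _ => sq_nonneg _)
      (Finset.mem_univ k))

/-- The quadratic form of `covMatrix θ mu`. -/
def covForm (θ : Fin K → ℝ) (mu : ℝ) (v : Fin L → ℂ) : ℝ :=
  ∑ j, θ j * ‖star (S.h j) ⬝ᵥ v‖ ^ 2 + mu * ∑ l, ‖v l‖ ^ 2

variable {S} {θ : Fin K → ℝ} {mu : ℝ}

theorem covMatrix_mulVec (x : Fin L → ℂ) :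
    S.covMatrix θ mu *ᵥ x = ∑ j, ((θ j : ℂ) * (star (S.h j) ⬝ᵥ x)) • S.h j + (mu : ℂ) • x := by
  have h1 : S.channelᴴ *ᵥ x = fun j => star (S.h j) ⬝ᵥ x := rfl
  rw [covMatrix, Matrix.add_mulVec, Matrix.smul_mulVec, Matrix.one_mulVec, ← Matrix.mulVec_mulVec,
    ← Matrix.mulVec_mulVec, h1]
  congr 1
  ext l
  simp only [Matrix.mulVec, dotProduct, channel, Matrix.of_apply, Matrix.diagonal_apply, ite_mul,
    zero_mul, Finset.sum_ite_eq, Finset.mem_univ, if_true, Finset.sum_apply, Pi.smul_apply,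
    smul_eq_mul]
  exact Finset.sum_congr rfl fun j _ => mul_comm _ _

theorem star_covMatrix_mulVec_dotProduct (x y : Fin L → ℂ) :
    (star (S.covMatrix θ mu *ᵥ x) ⬝ᵥ y).re =
      ∑ j, θ j * (star (star (S.h j) ⬝ᵥ x) * (star (S.h j) ⬝ᵥ y)).re +
        mu * ∑ l, (star (x l) * y l).re := by
  rw [covMatrix_mulVec, star_add, star_sum, add_dotProduct, sum_dotProduct, Complex.add_re,
    Complex.re_sum]
  congr 1
  · refine Finset.sum_congr rfl fun j _ => ?_
    rw [star_smul, smul_dotProduct, smul_eq_mul, star_mul', mul_assoc, Complex.star_def,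
      Complex.conj_ofReal, Complex.re_ofReal_mul]
  · rw [star_smul, smul_dotProduct, smul_eq_mul, Complex.star_def, Complex.conj_ofReal,
      Complex.re_ofReal_mul, dotProduct, Complex.re_sum]
    rfl

theorem norm_sub_sq_complex (a b : ℂ) : ‖b - a‖ ^ 2 = ‖b‖ ^ 2 - 2 * (star a * b).re + ‖a‖ ^ 2 := by
  simp only [← Complex.normSq_eq_norm_sq, Complex.normSq_apply, Complex.star_def, Complex.mul_re,
    Complex.conj_re, Complex.conj_im, Complex.sub_re, Complex.sub_im]
  ring

theorem covForm_sub (x y : Fin L → ℂ) :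
    S.covForm θ mu (y - x) = S.covForm θ mu y - 2 * (star (S.covMatrix θ mu *ᵥ x) ⬝ᵥ y).re +
      S.covForm θ mu x := by
  rw [star_covMatrix_mulVec_dotProduct]
  simp only [covForm, dotProduct_sub, Pi.sub_apply, norm_sub_sq_complex, mul_add, mul_sub,
    Finset.sum_add_distrib, Finset.sum_sub_distrib, Finset.mul_sum, ← mul_assoc, mul_comm _ (2 : ℝ)]
  ring

theorem covForm_self (x : Fin L → ℂ) :
    (star (S.covMatrix θ mu *ᵥ x) ⬝ᵥ x).re = S.covForm θ mu x := by
  rw [star_covMatrix_mulVec_dotProduct, covForm]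
  have : ∀ a : ℂ, (star a * a).re = ‖a‖ ^ 2 := fun a => by
    rw [Complex.star_def, mul_comm, Complex.mul_conj, Complex.ofReal_re, Complex.normSq_eq_norm_sq]
  simp only [this]

theorem le_covForm (hθ : ∀ j, 0 ≤ θ j) (v : Fin L → ℂ) :
    mu * ∑ l, ‖v l‖ ^ 2 ≤ S.covForm θ mu v :=
  le_add_of_nonneg_left (Finset.sum_nonneg fun j _ => mul_nonneg (hθ j) (sq_nonneg _))

theorem isUnit_covMatrix_det (hθ : ∀ j, 0 ≤ θ j) (hmu : 0 < mu) :
    IsUnit (S.covMatrix θ mu).det := by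
  rw [isUnit_iff_ne_zero]
  intro h0
  obtain ⟨v, hv, hv0⟩ := Matrix.exists_mulVec_eq_zero_iff.2 h0
  have h1 := covForm_self (S := S) (θ := θ) (mu := mu) v
  rw [hv0, star_zero, zero_dotProduct, Complex.zero_re] at h1
  have h2 := le_covForm (S := S) (mu := mu) hθ v
  have h3 : ∑ l, ‖v l‖ ^ 2 = 0 :=
    le_antisymm (by nlinarith) (Finset.sum_nonneg fun _ _ => sq_nonneg _)
  refine hv (funext fun l => ?_)
  have := (Finset.sum_eq_zero_iff_of_nonneg fun l _ => sq_nonneg _).1 h3 l (Finset.mem_univ l)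
  simpa using this

/-- Completing the square for one beamformer. -/
theorem covForm_complete_square (hθ : ∀ j, 0 ≤ θ j) (hmu : 0 < mu) (d y : Fin L → ℂ) :
    2 * (star d ⬝ᵥ y).re - S.covForm θ mu y +
        S.covForm θ mu (y - (S.covMatrix θ mu)⁻¹ *ᵥ d) =
      2 * (star d ⬝ᵥ ((S.covMatrix θ mu)⁻¹ *ᵥ d)).re -
        S.covForm θ mu ((S.covMatrix θ mu)⁻¹ *ᵥ d) := by
  set x := (S.covMatrix θ mu)⁻¹ *ᵥ d with hx
  have hd : d = S.covMatrix θ mu *ᵥ x := by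
    rw [hx, Matrix.mulVec_mulVec, Matrix.mul_nonsing_inv _ (isUnit_covMatrix_det hθ hmu),
      Matrix.one_mulVec]
  rw [covForm_sub, ← hd, ← covForm_self (θ := θ) (mu := mu) x, ← hd]
  ring

variable (S)

/-- The Lagrange function splits over the columns of `W`. -/
theorem lagrangian_columns (W : Matrix (Fin L) (Fin (K + 1)) ℂ) (lam : Fin K → ℝ) (mu : ℝ) :
    ∑ k, S.δ k * S.gPrivate W k + ∑ k, lam k * S.gCommon W k - mu * (power W - S.Pt) =
      (∑ k, S.δ k * (-S.αp k - ‖S.βp k‖ ^ 2 * S.noise k + Real.log (1 + S.αp k)) +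
        ∑ k, lam k * (-S.αc k - ‖S.βc k‖ ^ 2 * S.noise k + Real.log (1 + S.αc k)) + mu * S.Pt) +
      (2 * (star (S.channel *ᵥ S.dc lam) ⬝ᵥ W.col 0).re - S.covForm (S.θc lam) mu (W.col 0)) +
      ∑ k : Fin K, (2 * (star (S.dp k • S.h k) ⬝ᵥ W.col k.succ).re -
        S.covForm (S.θp lam) mu (W.col k.succ)) := by
  have hpow : power W = ∑ l, ‖W.col 0 l‖ ^ 2 + ∑ k : Fin K, ∑ l, ‖W.col k.succ l‖ ^ 2 := by
    rw [power_eq_sum, Finset.sum_comm, Fin.sum_univ_succ]; rfl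
  have hc : (star (S.channel *ᵥ S.dc lam) ⬝ᵥ W.col 0).re =
      ∑ k, lam k * (√(1 + S.αc k) * (star (S.βc k) * S.gain W k 0).re) := by
    have : S.channel *ᵥ S.dc lam = ∑ k, S.dc lam k • S.h k := by
      ext l
      simp [Matrix.mulVec, dotProduct, channel, mul_comm]
    rw [this, star_sum, sum_dotProduct, Complex.re_sum]
    refine Finset.sum_congr rfl fun k _ => ?_
    rw [star_smul, smul_dotProduct, smul_eq_mul, dc, star_mul', star_mul']
    simp only [Complex.star_def, Complex.conj_ofReal]
    rw [← Complex.re_ofReal_mul, ← Complex.re_ofReal_mul]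
    congr 1
    simp only [gain]
    ring
  have hp : ∀ k : Fin K, (star (S.dp k • S.h k) ⬝ᵥ W.col k.succ).re =
      S.δ k * (√(1 + S.αp k) * (star (S.βp k) * S.gain W k k.succ).re) := by
    intro k
    rw [star_smul, smul_dotProduct, smul_eq_mul, dp, star_mul', star_mul']
    simp only [Complex.star_def, Complex.conj_ofReal]
    rw [← Complex.re_ofReal_mul, ← Complex.re_ofReal_mul]
    congr 1
    simp only [gain]
    ring
  have hf : ∀ i, ∀ θ : Fin K → ℝ, S.covForm θ mu (W.col i) =
      ∑ j, θ j * ‖S.gain W j i‖ ^ 2 + mu * ∑ l, ‖W.col i l‖ ^ 2 := fun _ _ => rfl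
  have hswap : ∑ k : Fin K, ∑ j, S.θp lam j * ‖S.gain W j k.succ‖ ^ 2 =
      ∑ j, S.δ j * (‖S.βp j‖ ^ 2 * ∑ k : Fin K, ‖S.gain W j k.succ‖ ^ 2) +
      ∑ j, lam j * (‖S.βc j‖ ^ 2 * ∑ k : Fin K, ‖S.gain W j k.succ‖ ^ 2) := by
    rw [Finset.sum_comm, ← Finset.sum_add_distrib]
    refine Finset.sum_congr rfl fun j _ => ?_
    rw [← Finset.mul_sum, θp]; ring
  simp only [hf, hc, hp, Finset.sum_sub_distrib, Finset.sum_add_distrib, hswap, ← Finset.mul_sum,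
    hpow]
  have e1 : ∀ k, S.δ k * S.gPrivate W k =
      S.δ k * (-S.αp k - ‖S.βp k‖ ^ 2 * S.noise k + Real.log (1 + S.αp k)) +
      2 * (S.δ k * (√(1 + S.αp k) * (star (S.βp k) * S.gain W k k.succ).re)) -
      S.δ k * (‖S.βp k‖ ^ 2 * ∑ j : Fin K, ‖S.gain W k j.succ‖ ^ 2) := fun k => by
    rw [gPrivate]; ring
  have e2 : ∀ k, lam k * S.gCommon W k =
      lam k * (-S.αc k - ‖S.βc k‖ ^ 2 * S.noise k + Real.log (1 + S.αc k)) +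
      2 * (lam k * (√(1 + S.αc k) * (star (S.βc k) * S.gain W k 0).re)) -
      S.θc lam k * ‖S.gain W k 0‖ ^ 2 -
      lam k * (‖S.βc k‖ ^ 2 * ∑ j : Fin K, ‖S.gain W k j.succ‖ ^ 2) := fun k => by
    rw [gCommon, Fin.sum_univ_succ, θc]; ring
  simp only [e1, e2, Finset.sum_sub_distrib, Finset.sum_add_distrib, ← Finset.mul_sum]
  ring

/-- The columns decouple, and completing the square in each shows that the gap to the maximum is the
covariance form of `W - beamformer`. This form contains `mu` times the squared Frobenius norm. -/
theorem lagrangian_strong_max {lam : Fin K → ℝ} {mu : ℝ} (hlam : ∀ k, 0 ≤ lam k) (hmu : 0 < mu)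
    (W : Matrix (Fin L) (Fin (K + 1)) ℂ) :
    (∑ k, S.δ k * S.gPrivate W k + ∑ k, lam k * S.gCommon W k - mu * (power W - S.Pt)) +
        mu * ‖W - S.beamformer lam mu‖ ^ 2 ≤
      ∑ k, S.δ k * S.gPrivate (S.beamformer lam mu) k +
        ∑ k, lam k * S.gCommon (S.beamformer lam mu) k -
        mu * (power (S.beamformer lam mu) - S.Pt) := by
  have hθc : ∀ j, 0 ≤ S.θc lam j := fun j => mul_nonneg (hlam j) (sq_nonneg _)
  have hθp : ∀ j, 0 ≤ S.θp lam j := fun j =>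
    add_nonneg (mul_nonneg (S.δ_nonneg j) (sq_nonneg _)) (mul_nonneg (hlam j) (sq_nonneg _))
  set X := S.beamformer lam mu with hX
  have hX0 : X.col 0 = (S.covMatrix (S.θc lam) mu)⁻¹ *ᵥ (S.channel *ᵥ S.dc lam) := rfl
  have hXk : ∀ k : Fin K, X.col k.succ = (S.covMatrix (S.θp lam) mu)⁻¹ *ᵥ (S.dp k • S.h k) :=
    fun k => by rw [Matrix.mulVec_smul]; rfl
  have h0 := covForm_complete_square (S := S) hθc hmu (S.channel *ᵥ S.dc lam) (W.col 0)
  have hk := fun k : Fin K =>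
    covForm_complete_square (S := S) hθp hmu (S.dp k • S.h k) (W.col k.succ)
  rw [← hX0] at h0
  simp only [← hXk] at hk
  have hpow : power (W - X) = ∑ l, ‖(W.col 0 - X.col 0) l‖ ^ 2 +
      ∑ k : Fin K, ∑ l, ‖(W.col k.succ - X.col k.succ) l‖ ^ 2 := by
    rw [power_eq_sum, Finset.sum_comm, Fin.sum_univ_succ]; rfl
  have b0 := le_covForm (S := S) (mu := mu) hθc (W.col 0 - X.col 0)
  have bk := Finset.sum_le_sum fun (k : Fin K) (_ : k ∈ Finset.univ) =>
    le_covForm (S := S) (mu := mu) hθp (W.col k.succ - X.col k.succ)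
  have hks := Finset.sum_congr rfl fun (k : Fin K) (_ : k ∈ Finset.univ) => hk k
  rw [Finset.sum_add_distrib] at hks
  rw [← Finset.mul_sum] at bk
  rw [S.lagrangian_columns W, S.lagrangian_columns X, ← power_eq_norm_sq, hpow]
  linarith

/-- The beamforming subproblem as a dual model. -/
def dualModel : DualModel (Fin K) (Matrix (Fin L) (Fin (K + 1)) ℂ) where
  f0 W := ∑ k, S.δ k * S.gPrivate W k
  f k W := S.gCommon W k
  q W := power W
  w := S.beamformer
  P := S.Pt
  s := S.maxWeight
  -- Both sums are nonnegative, so one constant bounds the objective and every common rate.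
  C := ∑ k, S.δ k * (1 + Real.log (1 + S.αp k)) + ∑ k, (1 + Real.log (1 + S.αc k))
  quad0 := IsConcaveQuadratic.sum _ fun k =>
    (S.isConcaveQuadratic_gPrivate k).const_mul (S.δ_nonneg k)
  quad := S.isConcaveQuadratic_gCommon
  quadq := isConcaveQuadratic_neg_power
  sq_norm_le_q W := (power_eq_norm_sq W).ge
  q_zero := by simp [power]
  f0_le W := by
    have h : ∀ k, 0 ≤ 1 + Real.log (1 + S.αc k) := fun k =>
      add_nonneg zero_le_one (Real.log_nonneg (by linarith [S.αc_nonneg k]))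
    refine le_add_of_le_of_nonneg (Finset.sum_le_sum fun k _ => ?_)
      (Finset.sum_nonneg fun k _ => h k)
    exact mul_le_mul_of_nonneg_left (S.gPrivate_le W k) (S.δ_nonneg k)
  f_le k W := by
    have h : ∀ k, 0 ≤ 1 + Real.log (1 + S.αc k) := fun k =>
      add_nonneg zero_le_one (Real.log_nonneg (by linarith [S.αc_nonneg k]))
    refine le_add_of_nonneg_of_le (Finset.sum_nonneg fun k _ => ?_) ((S.gCommon_le W k).trans
      (Finset.single_le_sum (f := fun k => 1 + Real.log (1 + S.αc k)) (fun k _ => h k)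
        (Finset.mem_univ k)))
    exact mul_nonneg (S.δ_nonneg k)
      (add_nonneg zero_le_one (Real.log_nonneg (by linarith [S.αp_nonneg k])))
  P_pos := S.Pt_pos
  strong_max lam mu hlam hmu W := S.lagrangian_strong_max hlam hmu W

end Subproblem

/-! ### The original dual problem: existence of solutions and positivity of the power multiplier. -/

namespace Subproblem

variable {K L : ℕ} (S : Subproblem K L) {lam : Fin K → ℝ} {mu : ℝ}

theorem lagrangian_eq_lag (hlam : ∑ k, lam k = S.maxWeight)
    (W : Matrix (Fin L) (Fin (K + 1)) ℂ) (y : ℝ) :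
    S.lagrangian W y lam mu = S.dualModel.lag W lam mu := by
  simp only [lagrangian, DualModel.lag, dualModel, mul_sub, Finset.sum_sub_distrib,
    ← Finset.sum_mul, hlam]
  ring

theorem lagrangian_le_dualFunction (W : Matrix (Fin L) (Fin (K + 1)) ℂ) (y : ℝ)
    (lam : Fin K → ℝ) (mu : ℝ) : (S.lagrangian W y lam mu : EReal) ≤ S.dualFunction lam mu :=
  le_iSup₂_of_le W y le_rfl

theorem dualFunction_le (hlam : ∑ k, lam k = S.maxWeight) {D : ℝ}
    (h : ∀ W, S.dualModel.lag W lam mu ≤ D) : S.dualFunction lam mu ≤ D :=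
  iSup₂_le fun W y => by
    rw [S.lagrangian_eq_lag hlam]
    exact EReal.coe_le_coe (h W)

theorem dualFunction_eq (hlam : lam ∈ S.dualModel.simplex) (hmu : 0 < mu) :
    S.dualFunction lam mu = S.dualModel.dual lam mu := by
  refine le_antisymm (S.dualFunction_le hlam.2 fun W => DualModel.lag_le_dual hlam.1 hmu W) ?_
  rw [DualModel.dual, ← S.lagrangian_eq_lag hlam.2 _ 0]
  exact S.lagrangian_le_dualFunction _ _ _ _

/-- The Lagrangian is affine in the unconstrained `y` with nonzero slope, so it is unbounded above.
This confines dual solutions to the simplex. -/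
theorem dualFunction_eq_top (hlam : ∑ k, lam k ≠ S.maxWeight) : S.dualFunction lam mu = ⊤ := by
  rw [EReal.eq_top_iff_forall_lt]
  intro x
  set c := S.maxWeight - ∑ k, lam k with hc
  have hc0 : c ≠ 0 := sub_ne_zero.2 hlam.symm
  set y := (x + 1 - S.lagrangian 0 0 lam mu) / c with hy
  have e : S.lagrangian 0 y lam mu = x + 1 := by
    have : S.lagrangian 0 y lam mu = S.lagrangian 0 0 lam mu + c * y := by
      simp only [lagrangian, mul_sub, Finset.sum_sub_distrib, ← Finset.sum_mul, hc]
      ring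
    rw [this, hy, mul_div_cancel₀ _ hc0]; ring
  refine lt_of_lt_of_le ?_ (S.lagrangian_le_dualFunction 0 y lam mu)
  rw [e]
  exact EReal.coe_lt_coe (by linarith)

theorem lowerSemicontinuous_dualFunction :
    LowerSemicontinuous fun z : (Fin K → ℝ) × ℝ => S.dualFunction z.1 z.2 := by
  refine lowerSemicontinuous_iSup fun W => lowerSemicontinuous_iSup fun y =>
    Continuous.lowerSemicontinuous ?_
  refine continuous_coe_real_ereal.comp ?_
  unfold lagrangian
  fun_prop

theorem isCompact_simplex_prod_Icc (a b : ℝ) :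
    IsCompact (S.dualModel.simplex ×ˢ Set.Icc a b) := by
  refine IsCompact.prod ?_ isCompact_Icc
  have h1 : IsClosed S.dualModel.simplex := by
    have e1 : IsClosed {lam : Fin K → ℝ | ∀ k, 0 ≤ lam k} := by
      rw [Set.ofPred_forall]
      exact isClosed_iInter fun k => isClosed_le continuous_const (continuous_apply k)
    exact e1.inter (isClosed_eq (by fun_prop) continuous_const)
  refine (isCompact_Icc (a := (0 : Fin K → ℝ)) (b := fun _ => S.dualModel.s)).of_isClosed_subset
    h1 fun lam hlam => ⟨fun k => hlam.1 k, fun k => ?_⟩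
  rw [← hlam.2]
  exact Finset.single_le_sum (fun j _ => hlam.1 j) (Finset.mem_univ k)

/-- The dual problem has a solution. -/
theorem exists_isDualOptimal {lam0 : Fin K → ℝ} {mu0 : ℝ} (hlam0 : lam0 ∈ S.dualModel.simplex)
    (hmu0 : 0 < mu0) :
    ∃ lam mu, lam ∈ S.dualModel.simplex ∧ S.IsDualOptimal lam mu := by
  obtain ⟨A, hA⟩ := S.dualModel.exists_lag_zero_ge
  set D0 := S.dualModel.dual lam0 mu0 with hD0
  -- Beyond `b`, coercivity makes the dual at least `D0`, so minimising over a compact set suffices;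
  -- lower semicontinuity includes `mu = 0`, where the dual may be infinite.
  set b := max mu0 ((D0 + A) / S.dualModel.P) with hb
  obtain ⟨z, hz, hmin⟩ := LowerSemicontinuousOn.exists_isMinOn
    (s := S.dualModel.simplex ×ˢ Set.Icc 0 b) ⟨(lam0, mu0), hlam0, hmu0.le, le_max_left _ _⟩
    (S.isCompact_simplex_prod_Icc 0 b) (S.lowerSemicontinuous_dualFunction.lowerSemicontinuousOn _)
  rw [isMinOn_iff] at hmin
  refine ⟨z.1, z.2, hz.1, hz.1.1, hz.2.1, fun lam mu hlam hmu => ?_⟩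
  by_cases hsum : ∑ k, lam k = S.maxWeight
  swap
  · rw [S.dualFunction_eq_top hsum]; exact le_top
  by_cases hmub : mu ≤ b
  · exact hmin (lam, mu) ⟨⟨hlam, hsum⟩, hmu, hmub⟩
  · refine (hmin (lam0, mu0) ⟨hlam0, hmu0.le, le_max_left _ _⟩).trans ?_
    refine le_trans ?_ (S.lagrangian_le_dualFunction 0 0 lam mu)
    rw [S.dualFunction_eq hlam0 hmu0, S.lagrangian_eq_lag hsum]
    refine EReal.coe_le_coe (le_trans ?_ (hA lam mu ⟨hlam, hsum⟩))
    have h1 := (le_max_right _ _).trans (not_le.1 hmub).le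
    rw [div_le_iff₀ S.dualModel.P_pos] at h1
    linarith

/-- If the power multiplier is positive at every dual solution, it is bounded below on a sublevel
set of the dual function. -/
theorem exists_sublevel_mu_bound (hfull : ∀ lam mu, S.IsDualOptimal lam mu → 0 < mu)
    {lamS : Fin K → ℝ} {muS : ℝ} (hlamS : lamS ∈ S.dualModel.simplex)
    (hopt : S.IsDualOptimal lamS muS) :
    ∃ ε ν : ℝ, 0 < ε ∧ 0 < ν ∧ ∀ lam mu, lam ∈ S.dualModel.simplex → 0 < mu →
      S.dualModel.dual lam mu ≤ S.dualModel.dual lamS muS + ε → ν ≤ mu := by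
  have hmuS := hfull _ _ hopt
  have hval := S.dualFunction_eq hlamS hmuS
  set Ds := S.dualModel.dual lamS muS with hDs
  have hoptOf : ∀ lam mu, lam ∈ S.dualModel.simplex → 0 ≤ mu → S.dualFunction lam mu ≤ Ds →
      0 < mu := fun lam mu hl hm hD => hfull lam mu
        ⟨hl.1, hm, fun lam' mu' hl' hm' => hD.trans (hval ▸ hopt.2.2 lam' mu' hl' hm')⟩
  -- the least power multiplier of a dual solution with `mu ≤ muS`
  have hcpt : IsCompact ((S.dualModel.simplex ×ˢ Set.Icc 0 muS) ∩
      {z : (Fin K → ℝ) × ℝ | S.dualFunction z.1 z.2 ≤ Ds}) :=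
    (S.isCompact_simplex_prod_Icc 0 muS).inter_right
      (S.lowerSemicontinuous_dualFunction.isClosed_preimage (Ds : EReal))
  obtain ⟨z, ⟨hz, hzD⟩, hzmin⟩ := hcpt.exists_isMinOn
    ⟨(lamS, muS), ⟨hlamS, hmuS.le, le_rfl⟩, hval.le⟩ (continuous_snd.continuousOn)
  rw [isMinOn_iff] at hzmin
  have hz0 : 0 < z.2 := hoptOf z.1 z.2 hz.1 hz.2.1 hzD
  -- The strip `mu ≤ z.2 / 2` lies below the least solution multiplier `z.2` and contains no
  -- solution. The dual attains its minimum on this compact strip, so that minimum is strictly above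
  -- `Ds`, which leaves room for `ε`.
  obtain ⟨x, hx, hxmin⟩ := LowerSemicontinuousOn.exists_isMinOn
    (s := S.dualModel.simplex ×ˢ Set.Icc 0 (z.2 / 2))
    ⟨(lamS, 0), hlamS, le_rfl, (half_pos hz0).le⟩
    (S.isCompact_simplex_prod_Icc 0 (z.2 / 2))
    (S.lowerSemicontinuous_dualFunction.lowerSemicontinuousOn _)
  rw [isMinOn_iff] at hxmin
  have hxD : (Ds : EReal) < S.dualFunction x.1 x.2 := by
    by_contra! hle
    have hx2 : x.2 ≤ z.2 / 2 := hx.2.2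
    have h1 : z.2 ≤ x.2 := hzmin x ⟨⟨hx.1, hx.2.1, by linarith [hz.2.2]⟩, hle⟩
    linarith
  obtain ⟨d, hd1, hd2⟩ := EReal.lt_iff_exists_real_btwn.1 hxD
  have hd1' : Ds < d := EReal.coe_lt_coe_iff.1 hd1
  refine ⟨d - Ds, z.2 / 2, sub_pos.2 hd1', half_pos hz0, fun lam mu hlam hmu hD => ?_⟩
  by_contra! hlt
  have h1 := hd2.trans_le (hxmin (lam, mu) ⟨hlam, hmu.le, hlt.le⟩)
  rw [S.dualFunction_eq hlam hmu, EReal.coe_lt_coe_iff] at h1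
  linarith

/-- Convergence of the hyperplane fixed point iteration to a dual solution. -/
theorem exists_hfpi_tendsto
    (hfull : ∀ (lam : Fin K → ℝ) (mu : ℝ), S.IsDualOptimal lam mu → 0 < mu)
    (lam0 : Fin K → ℝ) (mu0 : ℝ) (hlam0 : ∀ k, 0 ≤ lam0 k)
    (hsum0 : ∑ k, lam0 k = S.maxWeight) (hmu0 : 0 < mu0) :
    ∃ ρ : ℝ, 0 ≤ ρ ∧
      ∀ (lam : ℕ → Fin K → ℝ) (mu : ℕ → ℝ),
        lam 0 = lam0 → mu 0 = mu0 → S.IsHFPI ρ lam mu →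
        (∀ t k, 0 < S.hCommon (lam t) (mu t) k + ρ) ∧
        ∃ (lamStar : Fin K → ℝ) (muStar : ℝ), S.IsDualOptimal lamStar muStar ∧
          Tendsto (fun t => ∑ k, |lam t k - lamStar k|) atTop (𝓝 0) ∧
          Tendsto (fun t => |mu t - muStar|) atTop (𝓝 0) := by
  have hmem0 : lam0 ∈ S.dualModel.simplex := ⟨hlam0, hsum0⟩
  obtain ⟨lamS, muS, hlamS, hopt⟩ := S.exists_isDualOptimal hmem0 hmu0
  have hmuS := hfull _ _ hopt
  have hval := S.dualFunction_eq hlamS hmuS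
  have hmin : S.dualModel.IsMinimizer lamS muS := ⟨hlamS, hmuS, fun lam mu hl hm => by
    have := hopt.2.2 lam mu hl.1 hm.le
    rwa [hval, S.dualFunction_eq hl hm, EReal.coe_le_coe_iff] at this⟩
  obtain ⟨ε, ν, hε, hν, hsub⟩ := S.exists_sublevel_mu_bound hfull hlamS hopt
  obtain ⟨ρ, hρ, hconv⟩ := hmin.exists_converges hε hν hsub hmem0 hmu0
  refine ⟨ρ, hρ, fun lam mu hl hm hit => ?_⟩
  obtain ⟨hpos, lamL, muL, hlamL, hmuL, hW, hlim, hlim'⟩ := hconv lam mu hl hm fun t => by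
    obtain ⟨m, h⟩ := hit t
    exact ⟨m, h.worst, h.lam_ne, h.lam_worst, h.mu_eq⟩
  refine ⟨hpos, lamL, muL, ⟨hlamL.1, hmuL.le, fun lam' mu' hl' hm' => ?_⟩, ?_, ?_⟩
  · exact (S.dualFunction_le hlamL.2 hW).trans (hval ▸ hopt.2.2 lam' mu' hl' hm')
  · have h : ∀ k, Tendsto (fun t => |lam t k - lamL k|) atTop (𝓝 0) := fun k => by
      simpa using ((tendsto_pi_nhds.1 hlim k).sub_const (lamL k)).abs
    simpa using tendsto_finsetSum Finset.univ fun k _ => h k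
  · simpa using (hlim'.sub_const muL).abs

end Subproblem

end

theorem lemma4 {K L : ℕ} [NeZero K] (S : Subproblem K L)
    (hfull : ∀ (lam : Fin K → ℝ) (mu : ℝ), S.IsDualOptimal lam mu → 0 < mu)
    (lam0 : Fin K → ℝ) (mu0 : ℝ) (hlam0 : ∀ k, 0 ≤ lam0 k)
    (hsum0 : ∑ k, lam0 k = S.maxWeight) (hmu0 : 0 < mu0) :
    ∃ ρ : ℝ, 0 ≤ ρ ∧
      ∀ (lam : ℕ → Fin K → ℝ) (mu : ℕ → ℝ),
        lam 0 = lam0 → mu 0 = mu0 → S.IsHFPI ρ lam mu →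
        (∀ t k, 0 < S.hCommon (lam t) (mu t) k + ρ) ∧
        ∃ (lamStar : Fin K → ℝ) (muStar : ℝ), S.IsDualOptimal lamStar muStar ∧
          Tendsto (fun t => ∑ k, |lam t k - lamStar k|) atTop (𝓝 0) ∧
          Tendsto (fun t => |mu t - muStar|) atTop (𝓝 0) :=
  S.exists_hfpi_tendsto hfull lam0 mu0 hlam0 hsum0 hmu0
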